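/- **Setting.** Let $d\ge 1$, let $\Omega\subset\mathbb{R}^d$ be nonempty, open, bounded and convex, let $k\ge 1$ and $m\ge k-1$ be integers. Let $\Phi\in C^k(\mathbb{R}^d)$ have support equal to the closed Euclidean unit ball and be positive on the open unit ball. $C^k(\overline\Omega)$ is the space of $u\in C^k(\Omega)$ all of whose derivatives $D^\alpha u$, $|\alpha|\le k$, extend continuously to $\overline\Omega$, with norm $\|u\|_{C^k(\overline\Omega)}=\max_{|\alpha|\le k}\sup_{\overline\Omega}|D^\alpha u|$; $C(\overline\Omega)=C^0(\overline\Omega)$. For a finite nonempty $X\subset\Omega$ let $h_X=\sup_{x\in\Omega}\min_{y\in X}\|x-y\|_2$ and $q_X=\frac12\min_{y\ne z\in X}\|y-z\|_2$; $X$ is quasi-uniform with constant $c_q\ge 1$ if $q_X\le h_X\le c_q q_X$. For $\nu>1$ the moving least squares (MLS) operator $Q_X$ of degree $m$ with support radius $\delta=\nu h_X$ is given by $Q_Xf(x)=p^*(x)$, where $p^*$ minimizes $\sum_{y\in X}|f(y)-p(y)|^2\,\Phi((x-y)/\delta)$ over all polynomials $p$ of total degree at most $m$. It reproduces polynomials of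 degree $m$ if $Q_Xp=p$ on $\Omega$ for all such $p$. For $\nu>1$, $c_q\ge 1$, $H>0$ let $\mathcal{X}(\nu,c_q,H)$ be the class of all $X$ that are quasi-uniform with constant $c_q$, have $h_X\le H$, and for which $Q_X$ reproduces polynomials of degree $m$. For $0\le\ell\le k$ call $C_{k,\ell}>0$ an error constant for this class if for all $X\in\mathcal{X}(\nu,c_q,H)$ and all $f\in C^k(\overline\Omega)$ one has $f-Q_Xf\in C^\ell(\overline\Omega)$ and $$\|f-Q_Xf\|_{C^\ell(\overline\Omega)}\le C_{k,\ell}\,h_X^{k-\ell}\,\|f\|_{C^k(\overline\Omega)} .$$ **Theorem.** 1. There are $\nu_0>1$ and $H>0$ such that for all $\nu\ge\nu_0$ and $c_q\ge1$: for every $X$ that is quasi-uniform with constant $c_q$ and has $h_X\le H$, $Q_X$ reproduces polynomials of degree $m$; and for every $0\le\ell\le k$ an error constant $C_{k,\ell}$ for $\mathcal{X}(\nu,c_q,H)$ exists. 2. Let $\nu>1$, $c_q\ge1$, $H>0$, and let $C_{k,0},C_{k,k}$ be error constants for $\mathcal{X}(\nu,c_q,H)$. Let $\mu\in(0,1)$,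 let $X_1,X_2,\dots\in\mathcal{X}(\nu,c_q,H)$ have fill distances $h_j=h_{X_j}$ with $h_{j+1}=\mu h_j$ for $j\ge1$, and put $h_0=h_1/\mu$ and $Q_j=Q_{X_j}$ (with support radius $\delta_j=\nu h_j$). For $f\in C^k(\overline\Omega)$ let $f_0=0$, $e_0=f$ and, for $j\ge1$, $s_j=Q_je_{j-1}$, $f_j=f_{j-1}+s_j$, $e_j=e_{j-1}-s_j$. Then for every $n\ge1$ one has $f-f_n\in C(\overline\Omega)$ and $$\|f-f_n\|_{C(\overline\Omega)}\le\frac{C_{k,0}\,h_0^k}{C_{k,k}}\,\bigl(C_{k,k}\,\mu^k\bigr)^n\,\|f\|_{C^k(\overline\Omega)} .$$ Hence, if $C_{k,k}\mu^k<1$, then $\|f-f_n\|_{C(\overline\Omega)}\to0$ as $n\to\infty$. -/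

import Mathlib

namespace MultiscaleMLS

/-- `ℝ^d` with the Euclidean norm. -/
abbrev Pt (d : ℕ) : Type := EuclideanSpace ℝ (Fin d)

/-- The partial derivative `∂_{i 0} ⋯ ∂_{i (n-1)} u (x)`. As `i` runs through all index sequences of
length `n`, these are the derivatives `D^α u` with `|α| = n`. -/
noncomputable def partialDeriv {d n : ℕ} (i : Fin n → Fin d) (u : Pt d → ℝ) (x : Pt d) : ℝ :=
  iteratedFDeriv ℝ n u x (fun j => EuclideanSpace.single (i j) (1 : ℝ))

/-- `u ∈ C^k(closure Ω)`, for open `Ω`: `u` is `C^k` on `Ω`, and each `D^α u` with `|α| ≤ k` extends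
continuously to the closure. Only the values of `u` on `Ω` matter. -/
def MemCk {d : ℕ} (Ω : Set (Pt d)) (k : ℕ) (u : Pt d → ℝ) : Prop :=
  ContDiffOn ℝ k u Ω ∧
    ∀ n ≤ k, ∀ i : Fin n → Fin d, ∃ g : Pt d → ℝ,
      ContinuousOn g (closure Ω) ∧ Set.EqOn g (partialDeriv i u) Ω

/-- The norm `max_{|α| ≤ k} sup |D^α u|` of `C^k(closure Ω)`. By continuity of the extensions the
suprema over `Ω` and over its closure agree; for `u ∈ C^k(closure Ω)` and bounded `Ω` the set is
bounded. -/
noncomputable def normCk {d : ℕ} (Ω : Set (Pt d)) (k : ℕ) (u : Pt d → ℝ) : ℝ :=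
  sSup {t : ℝ | ∃ n ≤ k, ∃ i : Fin n → Fin d, ∃ x ∈ Ω, t = |partialDeriv i u x|}

/-- Value of a `d`-variate polynomial at a point. -/
noncomputable def polyEval {d : ℕ} (p : MvPolynomial (Fin d) ℝ) (x : Pt d) : ℝ :=
  MvPolynomial.eval (fun i => x i) p

/-- `p` is a polynomial of total degree at most `m` that minimizes
`∑_{y ∈ X} |f y - p y|² Φ((x - y) / δ)` among all such polynomials. -/
def IsMLSMinimizer {d : ℕ} (m : ℕ) (Φ : Pt d → ℝ) (δ : ℝ) (X : Finset (Pt d))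
    (f : Pt d → ℝ) (x : Pt d) (p : MvPolynomial (Fin d) ℝ) : Prop :=
  p.totalDegree ≤ m ∧
    ∀ q : MvPolynomial (Fin d) ℝ, q.totalDegree ≤ m →
      ∑ y ∈ X, |f y - polyEval p y| ^ 2 * Φ (δ⁻¹ • (x - y)) ≤
        ∑ y ∈ X, |f y - polyEval q y| ^ 2 * Φ (δ⁻¹ • (x - y))

open Classical in
/-- The moving least squares approximation of degree `m` with weights
`w_y(x) = Φ((x - y) / δ)`, `y ∈ X`: its value at `x` is `p*(x)` with a minimizer `p*` for `x`. -/
noncomputable def mls {d : ℕ} (m : ℕ) (Φ : Pt d → ℝ) (δ : ℝ) (X : Finset (Pt d))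
    (f : Pt d → ℝ) (x : Pt d) : ℝ :=
  if h : ∃ p, IsMLSMinimizer m Φ δ X f x p then polyEval h.choose x else 0

/-- The moving least squares operator reproduces polynomials of degree at most `m` on `Ω`. -/
def Reproduces {d : ℕ} (Ω : Set (Pt d)) (m : ℕ) (Φ : Pt d → ℝ) (δ : ℝ)
    (X : Finset (Pt d)) : Prop :=
  ∀ p : MvPolynomial (Fin d) ℝ, p.totalDegree ≤ m →
    ∀ x ∈ Ω, mls m Φ δ X (polyEval p) x = polyEval p x

/-- The weight function: of class `C^k`, with support the closed unit ball, and positive on the open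
unit ball. -/
structure IsWeight {d : ℕ} (k : ℕ) (Φ : Pt d → ℝ) : Prop where
  contDiff : ContDiff ℝ k Φ
  tsupport_eq : tsupport Φ = Metric.closedBall 0 1
  pos : ∀ x ∈ Metric.ball (0 : Pt d) 1, 0 < Φ x

/-- Fill distance `sup_{x ∈ Ω} min_{y ∈ X} ‖x - y‖`. -/
noncomputable def fillDist {d : ℕ} (Ω : Set (Pt d)) (X : Finset (Pt d)) : ℝ :=
  sSup ((fun x => Metric.infDist x (X : Set (Pt d))) '' Ω)

/-- Separation radius `½ min_{y ≠ z} ‖y - z‖`. -/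
noncomputable def sepRadius {d : ℕ} (X : Finset (Pt d)) : ℝ :=
  sInf {t : ℝ | ∃ y ∈ X, ∃ z ∈ X, y ≠ z ∧ t = dist y z} / 2

/-- `X` is a finite nonempty subset of `Ω`, quasi-uniform with constant `cq`. -/
structure QuasiUniform {d : ℕ} (Ω : Set (Pt d)) (cq : ℝ) (X : Finset (Pt d)) : Prop where
  nonempty : X.Nonempty
  subset : (X : Set (Pt d)) ⊆ Ω
  sep_le_fill : sepRadius X ≤ fillDist Ω X
  fill_le_sep : fillDist Ω X ≤ cq * sepRadius X

/-- The moving least squares operator of degree `m` on `X` with support radius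
`δ = ν h_{X,Ω}`. -/
noncomputable def quasiInterp {d : ℕ} (Ω : Set (Pt d)) (m : ℕ) (Φ : Pt d → ℝ) (ν : ℝ)
    (X : Finset (Pt d)) (f : Pt d → ℝ) : Pt d → ℝ :=
  mls m Φ (ν * fillDist Ω X) X f

/-- The data sets under consideration: quasi-uniform with constant `cq`, of fill distance at most
`H`, with reproduction of polynomials of degree `m` for the support radius `ν h_{X,Ω}`. -/
structure IsDataSet {d : ℕ} (Ω : Set (Pt d)) (m : ℕ) (Φ : Pt d → ℝ) (ν cq H : ℝ)
    (X : Finset (Pt d)) : Prop where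
  quasiUniform : QuasiUniform Ω cq X
  fill_le : fillDist Ω X ≤ H
  reproduces : Reproduces Ω m Φ (ν * fillDist Ω X) X

/-- `C > 0` is a constant `C_{k,ℓ}` for the single-level error estimate
`‖f - Q_X f‖_{C^ℓ} ≤ C h_X^{k-ℓ} ‖f‖_{C^k}`, uniformly in the data set `X` and in
`f ∈ C^k(closure Ω)`; in particular `f - Q_X f` belongs to `C^ℓ(closure Ω)`. -/
def IsErrorConst {d : ℕ} (Ω : Set (Pt d)) (m k : ℕ) (Φ : Pt d → ℝ) (ν cq H : ℝ)
    (l : ℕ) (C : ℝ) : Prop :=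
  0 < C ∧
    ∀ X : Finset (Pt d), IsDataSet Ω m Φ ν cq H X →
      ∀ f : Pt d → ℝ, MemCk Ω k f →
        MemCk Ω l (f - quasiInterp Ω m Φ ν X f) ∧
          normCk Ω l (f - quasiInterp Ω m Φ ν X f) ≤
            C * fillDist Ω X ^ (k - l) * normCk Ω k f

/-- The residuals `e_0 = f`, `e_j = e_{j-1} - Q_j e_{j-1}` of the multiscale algorithm
(only `X 1, X 2, …` are used). -/
noncomputable def residual {d : ℕ} (Ω : Set (Pt d)) (m : ℕ) (Φ : Pt d → ℝ) (ν : ℝ)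
    (X : ℕ → Finset (Pt d)) (f : Pt d → ℝ) : ℕ → Pt d → ℝ
  | 0 => f
  | j + 1 => residual Ω m Φ ν X f j - quasiInterp Ω m Φ ν (X (j + 1)) (residual Ω m Φ ν X f j)

/-- The approximations `f_0 = 0`, `f_j = f_{j-1} + Q_j e_{j-1}` of the multiscale algorithm. -/
noncomputable def approximant {d : ℕ} (Ω : Set (Pt d)) (m : ℕ) (Φ : Pt d → ℝ) (ν : ℝ)
    (X : ℕ → Finset (Pt d)) (f : Pt d → ℝ) : ℕ → Pt d → ℝ
  | 0 => 0
  | j + 1 => approximant Ω m Φ ν X f j + quasiInterp Ω m Φ ν (X (j + 1)) (residual Ω m Φ ν X f j)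

end MultiscaleMLS

/-! Part 1 is a compactness argument in rescaled coordinates. Around `x₀` in the closure of `Ω`,
write the sites within `2δ` as `x₀ + σ • z j`, with `σ` a fixed multiple `M` of the fill distance.
The `z j` stay in a fixed ball, and quasi-uniformity bounds their number. Near `x₀` the MLS operator
is a sum of shape functions, which depend on the rescaled point and sites in a `C^k` way wherever
the Gram operator is invertible.

The crux is a lower bound for the Gram form, uniform up to the boundary
(`exists_uniform_coercivity`). By convexity `Ω` contains, at scale `σ`, a unit ball with bounded
rescaled centre. A normalized polynomial is bounded below on a small ball around some point of it
(`exists_uniform_lower_bound`), and that small ball contains a site. The admissible configurations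
then form compact sets, which bounds the derivatives of the shape functions.

For the error at `x₀`, subtract the Taylor polynomial of degree `k - 1 ≤ m`, which is reproduced.
The remainder is `O(σ ^ k)` at the sites and `l` derivatives of a shape function cost `σ⁻¹ ^ l`,
leaving `σ ^ (k - l)` (`norm_iteratedFDeriv_error_le`).

Part 2: every level multiplies the `C^k` norm of the residual by at most `C_{k,k}`, and the last
level alone, measured in the sup norm, yields `h_n ^ k`. -/

namespace MultiscaleMLS

open Set Filter Topology

/-! ### Symmetry of higher derivatives. -/

section Symmetry

variable {E F : Type*} [NormedAddCommGroup E] [NormedSpace ℝ E] [NormedAddCommGroup F]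
  [NormedSpace ℝ F]

/-- Interchanging two neighbouring arguments does not change an iterated derivative. -/
theorem iteratedFDeriv_comp_swap {f : E → F} (n : ℕ) (i : Fin n) {x : E}
    (hf : ContDiffAt ℝ (n + 1) f x) (v : Fin (n + 1) → E) :
    iteratedFDeriv ℝ (n + 1) f x (v ∘ Equiv.swap i.castSucc i.succ) =
      iteratedFDeriv ℝ (n + 1) f x v := by
  induction n generalizing x with
  | zero => exact i.elim0
  | succ n ih =>
    have hd : DifferentiableAt ℝ (iteratedFDeriv ℝ (n + 1) f) x :=
      (hf.iteratedFDeriv_right (m := 1) (by norm_cast; omega)).differentiableAt (by simp)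
    have happ : ∀ (w : Fin (n + 1) → E) (u : E),
        fderiv ℝ (fun y => iteratedFDeriv ℝ (n + 1) f y w) x u =
          (fderiv ℝ (iteratedFDeriv ℝ (n + 1) f) x u) w := by
      intro w u
      have := ((ContinuousMultilinearMap.apply ℝ (fun _ : Fin (n + 1) => E) F w).hasFDerivAt.comp
        x hd.hasFDerivAt).fderiv
      exact congrArg (fun T => T u) this
    -- Swapping the two outermost arguments is symmetry of a second derivative. Any other swap acts
    -- on the tail, where the induction hypothesis holds near `x` and can be differentiated.
    refine Fin.cases ?_ (fun j => ?_) i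
    · have hg : ContDiffAt ℝ 2 (iteratedFDeriv ℝ n f) x :=
        hf.iteratedFDeriv_right (by norm_cast; omega)
      have hg' : DifferentiableAt ℝ (fderiv ℝ (iteratedFDeriv ℝ n f)) x :=
        (hg.fderiv_right (m := 1) (by norm_num)).differentiableAt (by simp)
      have key : ∀ w : Fin (n + 2) → E, iteratedFDeriv ℝ (n + 2) f x w =
          (fderiv ℝ (fderiv ℝ (iteratedFDeriv ℝ n f)) x (w 0) (w 1)) (fun l => w l.succ.succ) := by
        intro w
        rw [iteratedFDeriv_succ_apply_left, ← happ]
        simp only [iteratedFDeriv_succ_apply_left]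
        have := ((ContinuousMultilinearMap.apply ℝ (fun _ : Fin n => E) F
          (Fin.tail (Fin.tail w))).hasFDerivAt.comp x
          (hg'.hasFDerivAt.clm_apply (hasFDerivAt_const (Fin.tail w 0) x))).fderiv
        refine (congrArg (fun T => T (w 0)) this).trans ?_
        simp
        rfl
      have hs := (hg.isSymmSndFDerivAt (by simp)).eq (v 0) (v 1)
      rw [key, key, hs]
      simp only [Function.comp_apply, Fin.castSucc_zero, Fin.succ_zero_eq_one,
        Equiv.swap_apply_left, Equiv.swap_apply_right]
      rw [show (fun l : Fin n => v ((Equiv.swap (0 : Fin (n + 2)) 1) l.succ.succ)) =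
        fun l => v l.succ.succ from funext fun l => by
          rw [Equiv.swap_apply_of_ne_of_ne (by simp [Fin.ext_iff]) (by simp [Fin.ext_iff])]]
    · have hev : ∀ᶠ y in 𝓝 x, ContDiffAt ℝ (n + 1) f y :=
        (hf.of_le (by norm_cast; omega)).eventually (by norm_cast; simp)
      have hcongr : (fun y => iteratedFDeriv ℝ (n + 1) f y
          (Fin.tail v ∘ Equiv.swap j.castSucc j.succ)) =ᶠ[𝓝 x]
          fun y => iteratedFDeriv ℝ (n + 1) f y (Fin.tail v) := by
        filter_upwards [hev] with y hy using ih j hy _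
      rw [iteratedFDeriv_succ_apply_left, iteratedFDeriv_succ_apply_left, ← happ, ← happ]
      have h0 : (v ∘ Equiv.swap j.succ.castSucc j.succ.succ) 0 = v 0 := by
        simp only [Function.comp_apply]
        rw [Equiv.swap_apply_of_ne_of_ne (by simp [Fin.ext_iff]) (by simp [Fin.ext_iff])]
      have ht : Fin.tail (v ∘ Equiv.swap j.succ.castSucc j.succ.succ) =
          Fin.tail v ∘ Equiv.swap j.castSucc j.succ := by
        funext l
        simp only [Fin.tail, Function.comp_apply]
        congr 1
        rw [← Fin.succ_castSucc]
        exact (Fin.succ_injective _).swap_apply _ _ _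
      rw [h0, ht, hcongr.fderiv_eq]

/-- The iterated derivatives of a `C^n` function on a real space are symmetric. -/
theorem iteratedFDeriv_comp_perm_of_contDiffAt {f : E → F} {n : ℕ} {x : E}
    (hf : ContDiffAt ℝ n f x) (v : Fin n → E) (σ : Equiv.Perm (Fin n)) :
    iteratedFDeriv ℝ n f x (v ∘ σ) = iteratedFDeriv ℝ n f x v := by
  cases n with
  | zero => rw [Subsingleton.elim (v ∘ σ) v]
  | succ n =>
    have hσ : σ ∈ Submonoid.closure
        (Set.range fun i : Fin n => Equiv.swap i.castSucc i.succ) := by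
      rw [Equiv.Perm.mclosure_swap_castSucc_succ]; trivial
    induction hσ using Submonoid.closure_induction generalizing v with
    | mem τ hτ =>
      obtain ⟨i, rfl⟩ := hτ
      exact iteratedFDeriv_comp_swap n i (by exact_mod_cast hf) v
    | one => rfl
    | mul a b _ _ ha hb =>
      rw [Equiv.Perm.coe_mul, ← Function.comp_assoc, hb, ha]

end Symmetry

/-! ### Multilinear forms and Taylor polynomials. -/

section Polynomials

variable {d : ℕ}

theorem contDiff_polyEval (p : MvPolynomial (Fin d) ℝ) {n : WithTop ℕ∞} :
    ContDiff ℝ n (polyEval p) := by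
  induction p using MvPolynomial.induction_on with
  | C a =>
    have : polyEval (MvPolynomial.C a) = fun _ : Pt d => a := by
      funext x; simp [polyEval]
    rw [this]; exact contDiff_const
  | add p q hp hq =>
    have : polyEval (p + q) = fun x => polyEval p x + polyEval q x := by
      funext x; simp [polyEval]
    rw [this]; exact hp.add hq
  | mul_X p i hp =>
    have : polyEval (p * MvPolynomial.X i) = fun x : Pt d => polyEval p x * x i := by
      funext x; simp [polyEval]
    rw [this]; exact hp.mul (by fun_prop)

/-- Expansion of a multilinear form in the standard basis. -/
theorem multilinear_apply_eq_sum {n : ℕ} (A : ContinuousMultilinearMap ℝ (fun _ : Fin n => Pt d) ℝ)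
    (v : Fin n → Pt d) :
    A v = ∑ i : Fin n → Fin d,
      (∏ j, v j (i j)) * A (fun j => EuclideanSpace.single (i j) (1 : ℝ)) := by
  have hv : v = fun j => ∑ l : Fin d, v j l • (EuclideanSpace.single l (1 : ℝ) : Pt d) := by
    funext j
    ext l
    simp [Finset.sum_apply, Pi.single_apply]
  conv_lhs => rw [hv]
  rw [A.map_sum]
  refine Finset.sum_congr rfl fun i _ => ?_
  rw [A.map_smul_univ, smul_eq_mul]

/-- A multilinear form is bounded in terms of its values on the standard basis. -/
theorem norm_multilinear_le {n : ℕ} (A : ContinuousMultilinearMap ℝ (fun _ : Fin n => Pt d) ℝ)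
    {M : ℝ} (hM : 0 ≤ M)
    (h : ∀ i : Fin n → Fin d, |A (fun j => EuclideanSpace.single (i j) (1 : ℝ))| ≤ M) :
    ‖A‖ ≤ (d : ℝ) ^ n * M := by
  refine A.opNorm_le_bound (by positivity) fun v => ?_
  rw [multilinear_apply_eq_sum A v]
  calc ‖∑ i : Fin n → Fin d, (∏ j, v j (i j)) * A (fun j => EuclideanSpace.single (i j) (1 : ℝ))‖
      ≤ ∑ _i : Fin n → Fin d, (∏ j, ‖v j‖) * M := by
        refine norm_sum_le_of_le _ fun i _ => ?_
        rw [norm_mul, norm_prod]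
        gcongr with j
        · exact PiLp.norm_apply_le (v j) (i j)
        · exact h i
    _ = (d : ℝ) ^ n * M * ∏ j, ‖v j‖ := by
        simp only [Finset.sum_const, Finset.card_univ, Fintype.card_fun, Fintype.card_fin,
          nsmul_eq_mul, Nat.cast_pow]
        ring

/-- A multilinear form on the diagonal, centred at `x₀`, is a polynomial. -/
theorem exists_polyEval_eq_multilinear {n : ℕ}
    (A : ContinuousMultilinearMap ℝ (fun _ : Fin n => Pt d) ℝ) (x₀ : Pt d) :
    ∃ p : MvPolynomial (Fin d) ℝ, p.totalDegree ≤ n ∧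
      ∀ x, polyEval p x = A (fun _ => x - x₀) := by
  refine ⟨∑ i : Fin n → Fin d, MvPolynomial.C (A (fun j => EuclideanSpace.single (i j) (1 : ℝ))) *
    ∏ j, (MvPolynomial.X (i j) - MvPolynomial.C (x₀ (i j))), ?_, fun x => ?_⟩
  · refine MvPolynomial.totalDegree_finsetSum_le fun i _ => ?_
    refine (MvPolynomial.totalDegree_mul _ _).trans ?_
    rw [MvPolynomial.totalDegree_C, zero_add]
    refine (MvPolynomial.totalDegree_finsetProd _ _).trans ?_
    calc ∑ j : Fin n, (MvPolynomial.X (i j) - MvPolynomial.C (x₀ (i j)) :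
          MvPolynomial (Fin d) ℝ).totalDegree ≤ ∑ _j : Fin n, 1 := by
          refine Finset.sum_le_sum fun j _ => ?_
          refine (MvPolynomial.totalDegree_sub _ _).trans ?_
          simp [MvPolynomial.totalDegree_X, MvPolynomial.totalDegree_C]
      _ = n := by simp
  · rw [multilinear_apply_eq_sum A]
    simp only [polyEval, map_sum, map_mul, map_prod, map_sub, MvPolynomial.eval_C,
      MvPolynomial.eval_X, PiLp.sub_apply]
    exact Finset.sum_congr rfl fun i _ => mul_comm _ _

/-- The Taylor polynomial of degree less than `k` of a `C^k` function. -/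
theorem exists_taylor_polynomial {f : Pt d → ℝ} {k : ℕ} (hk : 1 ≤ k) {x₀ : Pt d}
    (hf : ContDiffAt ℝ k f x₀) :
    ∃ p : MvPolynomial (Fin d) ℝ, p.totalDegree ≤ k - 1 ∧
      (∀ n < k, iteratedFDeriv ℝ n (polyEval p) x₀ = iteratedFDeriv ℝ n f x₀) ∧
      ∀ x, iteratedFDeriv ℝ k (polyEval p) x = 0 := by
  choose P hPdeg hPeval using fun n => exists_polyEval_eq_multilinear (iteratedFDeriv ℝ n f x₀) x₀
  set p : MvPolynomial (Fin d) ℝ :=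
    ∑ n ∈ Finset.range k, MvPolynomial.C ((n.factorial : ℝ)⁻¹) * P n with hp
  have hpe : ∀ x, polyEval p x = ∑ n ∈ Finset.range k,
      (n.factorial : ℝ)⁻¹ * iteratedFDeriv ℝ n f x₀ (fun _ => x - x₀) := by
    intro x
    rw [hp]
    simp only [← hPeval]
    simp only [polyEval, map_sum, map_mul, MvPolynomial.eval_C]
  let S : FormalMultilinearSeries ℝ (Pt d) ℝ := fun n =>
    if n < k then (n.factorial : ℝ)⁻¹ • iteratedFDeriv ℝ n f x₀ else 0
  have hS : HasFiniteFPowerSeriesOnBall (polyEval p) S x₀ k ⊤ := by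
    refine HasFiniteFPowerSeriesOnBall.mk' (fun n hn => ?_) (by simp) fun y _ => ?_
    · simp only [S, if_neg (not_lt.2 hn)]
    · rw [hpe]
      refine Finset.sum_congr rfl fun n hn => ?_
      simp only [S, if_pos (Finset.mem_range.1 hn), _root_.smul_apply,
        smul_eq_mul, add_sub_cancel_left]
  refine ⟨p, ?_, fun n hn => ?_, fun x => ?_⟩
  · refine MvPolynomial.totalDegree_finsetSum_le fun n hn => ?_
    refine (MvPolynomial.totalDegree_mul _ _).trans ?_
    rw [MvPolynomial.totalDegree_C, zero_add]
    have := hPdeg n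
    have := Finset.mem_range.1 hn
    omega
  · ext v
    rw [hS.toHasFPowerSeriesOnBall.iteratedFDeriv_eq_sum_of_completeSpace]
    -- The derivative of a power series is the sum of its coefficient over all permutations of the
    -- arguments. By symmetry of the derivatives of `f` the `n!` summands coincide and cancel `1 /
    -- n!`.
    have : ∀ σ : Equiv.Perm (Fin n), S n (fun i => v (σ i)) =
        (n.factorial : ℝ)⁻¹ * iteratedFDeriv ℝ n f x₀ v := by
      intro σ
      simp only [S, if_pos hn, _root_.smul_apply, smul_eq_mul]
      congr 1
      exact iteratedFDeriv_comp_perm_of_contDiffAt (hf.of_le (by exact_mod_cast hn.le)) v σ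
    rw [Finset.sum_congr rfl fun σ _ => this σ, Finset.sum_const, Finset.card_univ,
      Fintype.card_perm, Fintype.card_fin, nsmul_eq_mul, ← mul_assoc,
      mul_inv_cancel₀ (by positivity), one_mul]
  · ext v
    -- Recentred at `x`, the series still has no coefficients of order `k` or more.
    have h1 := hS.changeOrigin (y := x - x₀) (by simp)
    rw [add_sub_cancel] at h1
    rw [h1.toHasFPowerSeriesOnBall.iteratedFDeriv_eq_sum_of_completeSpace]
    simp [h1.finite k le_rfl]

end Polynomials

/-! ### Taylor remainder bounds on convex sets. -/

section Remainder

variable {E F : Type*} [NormedAddCommGroup E] [NormedSpace ℝ E] [NormedAddCommGroup F]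
  [NormedSpace ℝ F]

/-- If the derivatives of order less than `k` vanish at `x₀` and the `k`-th derivative is bounded,
then the function is of size `‖y - x₀‖ ^ k`. -/
theorem norm_iteratedFDeriv_le_of_vanishing {g : E → F} {Ω : Set E} (hΩo : IsOpen Ω)
    (hΩc : Convex ℝ Ω) {k : ℕ} (hg : ContDiffOn ℝ k g Ω) {M : ℝ} (hM : 0 ≤ M)
    (hb : ∀ x ∈ Ω, ‖iteratedFDeriv ℝ k g x‖ ≤ M) {x₀ : E} (hx₀ : x₀ ∈ Ω)
    (h0 : ∀ n < k, iteratedFDeriv ℝ n g x₀ = 0) (j : ℕ) (hj : j ≤ k) :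
    ∀ y ∈ Ω, ‖iteratedFDeriv ℝ (k - j) g y‖ ≤ M * ‖y - x₀‖ ^ j := by
  induction j with
  | zero => simpa using hb
  | succ j ih =>
    intro y hy
    have ih := ih (by omega)
    -- On this convex set the bound for the next derivative is uniform, so the mean value inequality
    -- gains one power of `‖y - x₀‖`.
    set s := Ω ∩ Metric.closedBall x₀ ‖y - x₀‖ with hs
    have hsc : Convex ℝ s := hΩc.inter (convex_closedBall _ _)
    have hkj : k - j = (k - (j + 1)) + 1 := by omega
    have hdiff : ∀ x ∈ s, DifferentiableAt ℝ (iteratedFDeriv ℝ (k - (j + 1)) g) x := fun x hx =>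
      ((hg.contDiffAt (hΩo.mem_nhds hx.1)).iteratedFDeriv_right (m := 1)
        (by norm_cast; omega)).differentiableAt (by simp)
    have hbd : ∀ x ∈ s, ‖fderiv ℝ (iteratedFDeriv ℝ (k - (j + 1)) g) x‖ ≤
        M * ‖y - x₀‖ ^ j := by
      intro x hx
      rw [norm_fderiv_iteratedFDeriv, ← hkj]
      refine (ih x hx.1).trans ?_
      have : ‖x - x₀‖ ≤ ‖y - x₀‖ := by simpa [dist_eq_norm] using hx.2
      gcongr
    have := hsc.norm_image_sub_le_of_norm_fderiv_le hdiff hbd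
      (x := x₀) (y := y) ⟨hx₀, by simp⟩ ⟨hy, by simp [dist_eq_norm]⟩
    rw [h0 _ (by omega), sub_zero] at this
    rw [pow_succ, ← mul_assoc]
    exact this

end Remainder

/-! ### Polynomials of bounded degree as a Euclidean space. -/

section PolynomialSpace

variable {d : ℕ}

theorem polyEval_sub (p q : MvPolynomial (Fin d) ℝ) (x : Pt d) :
    polyEval (p - q) x = polyEval p x - polyEval q x := by simp [polyEval]

/-- Polynomials of bounded degree are stable under affine changes of variables. -/
theorem exists_polyEval_affine {m : ℕ} (p : MvPolynomial (Fin d) ℝ) (hp : p.totalDegree ≤ m)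
    (x₀ : Pt d) (σ : ℝ) :
    ∃ q : MvPolynomial (Fin d) ℝ, q.totalDegree ≤ m ∧
      ∀ z, polyEval q z = polyEval p (x₀ + σ • z) := by
  refine ⟨MvPolynomial.bind₁
    (fun i => MvPolynomial.C (x₀ i) + MvPolynomial.C σ * MvPolynomial.X i) p, ?_, fun z => ?_⟩
  · rw [MvPolynomial.bind₁, MvPolynomial.aeval_def, MvPolynomial.eval₂_eq]
    refine MvPolynomial.totalDegree_finsetSum_le fun s hs => ?_
    refine (MvPolynomial.totalDegree_mul _ _).trans ?_
    rw [MvPolynomial.algebraMap_eq, MvPolynomial.totalDegree_C, zero_add]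
    refine (MvPolynomial.totalDegree_finsetProd _ _).trans ?_
    refine le_trans (Finset.sum_le_sum fun i _ => ?_)
      ((MvPolynomial.le_totalDegree hs).trans hp)
    refine (MvPolynomial.totalDegree_pow _ _).trans ?_
    refine (Nat.mul_le_mul_left _ (?_ : _ ≤ 1)).trans (mul_one _).le
    refine (MvPolynomial.totalDegree_add _ _).trans (max_le (by simp) ?_)
    refine (MvPolynomial.totalDegree_mul _ _).trans (by simp)
  · refine (MvPolynomial.eval₂Hom_bind₁ _ _ _ _).trans ?_
    refine congrArg (fun g => MvPolynomial.eval₂Hom (RingHom.id ℝ) g p) (funext fun i => ?_)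
    simp

/-- The coefficient space of the polynomials of degree at most `m`. -/
abbrev Coeff (d m : ℕ) : Type :=
  EuclideanSpace ℝ (Fin (Module.finrank ℝ (MvPolynomial.restrictTotalDegree (Fin d) ℝ m)))

/-- The values at `z` of a basis of the space of polynomials of degree at most `m`. -/
noncomputable def polyVec (d m : ℕ) (z : Pt d) : Coeff d m :=
  WithLp.toLp 2 fun i =>
    polyEval (Module.finBasis ℝ (MvPolynomial.restrictTotalDegree (Fin d) ℝ m) i).1 z

theorem contDiff_polyVec (d m : ℕ) {n : WithTop ℕ∞} : ContDiff ℝ n (polyVec d m) := by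
  rw [contDiff_euclidean]
  exact fun i => contDiff_polyEval _

/-- Identifies polynomials with coefficient vectors, so that the normal equations live in one
Euclidean space independent of the data. -/
theorem inner_polyVec {m : ℕ} (v : Coeff d m) (z : Pt d) :
    inner ℝ v (polyVec d m z) =
      polyEval (∑ i, v i • Module.finBasis ℝ (MvPolynomial.restrictTotalDegree (Fin d) ℝ m) i :
        MvPolynomial.restrictTotalDegree (Fin d) ℝ m).1 z := by
  simp [polyVec, PiLp.inner_apply, polyEval, mul_comm, MvPolynomial.smul_eval]

theorem exists_polyEval_eq_inner {m : ℕ} (v : Coeff d m) :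
    ∃ p : MvPolynomial (Fin d) ℝ, p.totalDegree ≤ m ∧
      ∀ z, polyEval p z = inner ℝ v (polyVec d m z) :=
  ⟨_, (MvPolynomial.mem_restrictTotalDegree _ _ _).1 (Subtype.property _),
    fun z => (inner_polyVec v z).symm⟩

theorem exists_inner_eq_polyEval {m : ℕ} (p : MvPolynomial (Fin d) ℝ) (hp : p.totalDegree ≤ m) :
    ∃ v : Coeff d m, ∀ z, polyEval p z = inner ℝ v (polyVec d m z) := by
  let b := Module.finBasis ℝ (MvPolynomial.restrictTotalDegree (Fin d) ℝ m)
  let p' : MvPolynomial.restrictTotalDegree (Fin d) ℝ m :=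
    ⟨p, (MvPolynomial.mem_restrictTotalDegree _ _ _).2 hp⟩
  refine ⟨WithLp.toLp 2 fun i => b.repr p' i, fun z => ?_⟩
  rw [inner_polyVec]
  exact congrArg (fun q : MvPolynomial.restrictTotalDegree (Fin d) ℝ m => polyEval q.1 z)
    (b.sum_repr p').symm

/-- A nonzero polynomial does not vanish identically on a ball. -/
theorem exists_inner_polyVec_ne_zero {m : ℕ} {v : Coeff d m} (hv : v ≠ 0) (w : Pt d) {r : ℝ}
    (hr : 0 < r) : ∃ z ∈ Metric.ball w r, inner ℝ v (polyVec d m z) ≠ 0 := by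
  by_contra! hcon
  let b := Module.finBasis ℝ (MvPolynomial.restrictTotalDegree (Fin d) ℝ m)
  -- A cube inside the ball is a product of infinite sets, and a polynomial vanishing on such a
  -- product is zero.
  obtain ⟨s, hs, hsub⟩ : ∃ s : ℝ, 0 < s ∧
      ∀ x : Fin d → ℝ, (∀ i, |x i - w i| < s) → WithLp.toLp 2 x ∈ Metric.ball w r := by
    have hc : Continuous fun x : Fin d → ℝ => (WithLp.toLp 2 x : Pt d) :=
      PiLp.continuous_toLp 2 _
    have : (fun x : Fin d → ℝ => (WithLp.toLp 2 x : Pt d)) ⁻¹' Metric.ball w r ∈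
        𝓝 (fun i => w i) :=
      hc.continuousAt.preimage_mem_nhds (Metric.ball_mem_nhds _ hr)
    obtain ⟨s, hs, h⟩ := Metric.mem_nhds_iff.1 this
    refine ⟨s, hs, fun x hx => h ?_⟩
    rw [Metric.mem_ball, dist_pi_lt_iff hs]
    exact fun i => by simpa [Real.dist_eq] using hx i
  have hzero : (∑ i, v i • b i : MvPolynomial.restrictTotalDegree (Fin d) ℝ m).1 = 0 := by
    refine MvPolynomial.funext_set (fun i => Metric.ball (w i) s) (fun i => ?_) fun x hx => ?_
    · rw [Real.ball_eq_Ioo]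
      exact Set.Ioo_infinite (by linarith)
    · have := hcon (WithLp.toLp 2 x) (hsub x fun i => by
        simpa [Real.dist_eq] using hx i trivial)
      rw [inner_polyVec] at this
      simpa [polyEval] using this
  have hli := Fintype.linearIndependent_iff.1 b.linearIndependent (fun i => v i)
    (Subtype.ext hzero)
  exact hv (by ext i; exact hli i)

end PolynomialSpace

/-! ### Normal equations and shape functions. -/

section LeastSquares

variable {d : ℕ}

/-- A polynomial satisfying the normal equations gives the moving least squares approximation, if
the data sites carrying weight are unisolvent at `x`. -/
theorem mls_eq_of_orthogonal {m : ℕ} {Φ : Pt d → ℝ} (hΦ : ∀ x, 0 ≤ Φ x) {δ : ℝ} {X : Finset (Pt d)}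
    {f : Pt d → ℝ} {x : Pt d} {p : MvPolynomial (Fin d) ℝ} (hp : p.totalDegree ≤ m)
    (horth : ∀ q : MvPolynomial (Fin d) ℝ, q.totalDegree ≤ m →
      ∑ y ∈ X, (f y - polyEval p y) * polyEval q y * Φ (δ⁻¹ • (x - y)) = 0)
    (huni : ∀ q : MvPolynomial (Fin d) ℝ, q.totalDegree ≤ m →
      ∑ y ∈ X, polyEval q y ^ 2 * Φ (δ⁻¹ • (x - y)) = 0 → polyEval q x = 0) :
    mls m Φ δ X f x = polyEval p x := by
  have pyth : ∀ q : MvPolynomial (Fin d) ℝ, q.totalDegree ≤ m →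
      ∑ y ∈ X, |f y - polyEval q y| ^ 2 * Φ (δ⁻¹ • (x - y)) =
        ∑ y ∈ X, |f y - polyEval p y| ^ 2 * Φ (δ⁻¹ • (x - y)) +
          ∑ y ∈ X, polyEval (p - q) y ^ 2 * Φ (δ⁻¹ • (x - y)) := by
    intro q hq
    have h := horth (p - q) ((MvPolynomial.totalDegree_sub _ _).trans (max_le hp hq))
    rw [← add_zero (∑ y ∈ X, |f y - polyEval p y| ^ 2 * Φ (δ⁻¹ • (x - y))),
      ← mul_zero (2 : ℝ), ← h, Finset.mul_sum, ← Finset.sum_add_distrib, ← Finset.sum_add_distrib]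
    refine Finset.sum_congr rfl fun y _ => ?_
    rw [sq_abs, sq_abs, polyEval_sub]
    ring
  have hmin : IsMLSMinimizer m Φ δ X f x p := by
    refine ⟨hp, fun q hq => ?_⟩
    rw [pyth q hq]
    exact le_add_of_nonneg_right (Finset.sum_nonneg fun y _ => mul_nonneg (sq_nonneg _) (hΦ _))
  have hex : ∃ p, IsMLSMinimizer m Φ δ X f x p := ⟨p, hmin⟩
  rw [mls, dif_pos hex]
  -- The chosen minimizer may differ from `p`. Comparing the minimal values shows that their
  -- difference has zero weighted square sum, so unisolvence gives equal values at `x`.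
  have hc := hex.choose_spec
  have h1 := hc.2 p hp
  rw [pyth _ hc.1] at h1
  have h2 : ∑ y ∈ X, polyEval (p - hex.choose) y ^ 2 * Φ (δ⁻¹ • (x - y)) = 0 :=
    le_antisymm (by linarith)
      (Finset.sum_nonneg fun y _ => mul_nonneg (sq_nonneg _) (hΦ _))
  have h3 := huni _ ((MvPolynomial.totalDegree_sub _ _).trans (max_le hp hc.1)) h2
  rw [polyEval_sub] at h3
  linarith

/-- The operator of the normal equations at `q.1` for the data sites `q.2`. -/
noncomputable def gram (m : ℕ) (Φ : Pt d → ℝ) (κ : ℝ) {n : ℕ} (q : Pt d × (Fin n → Pt d)) :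
    Coeff d m →L[ℝ] Coeff d m :=
  ∑ j, Φ (κ • (q.1 - q.2 j)) •
    (innerSL ℝ (polyVec d m (q.2 j))).smulRight (polyVec d m (q.2 j))

/-- The shape function of the `j`-th data site `q.2 j`, evaluated at `q.1`. -/
noncomputable def shape (m : ℕ) (Φ : Pt d → ℝ) (κ : ℝ) {n : ℕ} (j : Fin n)
    (q : Pt d × (Fin n → Pt d)) : ℝ :=
  Φ (κ • (q.1 - q.2 j)) *
    inner ℝ (polyVec d m q.1) ((gram m Φ κ q).inverse (polyVec d m (q.2 j)))

theorem gram_apply (m : ℕ) (Φ : Pt d → ℝ) (κ : ℝ) {n : ℕ} (q : Pt d × (Fin n → Pt d))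
    (v : Coeff d m) :
    gram m Φ κ q v = ∑ j, (Φ (κ • (q.1 - q.2 j)) * inner ℝ v (polyVec d m (q.2 j))) •
      polyVec d m (q.2 j) := by
  simp only [gram, _root_.sum_apply]
  refine Finset.sum_congr rfl fun j _ => ?_
  simp [smul_smul, real_inner_comm]

theorem inner_gram (m : ℕ) (Φ : Pt d → ℝ) (κ : ℝ) {n : ℕ} (q : Pt d × (Fin n → Pt d))
    (u v : Coeff d m) :
    inner ℝ u (gram m Φ κ q v) = ∑ j, Φ (κ • (q.1 - q.2 j)) * inner ℝ v (polyVec d m (q.2 j)) *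
      inner ℝ u (polyVec d m (q.2 j)) := by
  rw [gram_apply, inner_sum]
  exact Finset.sum_congr rfl fun j _ => real_inner_smul_right _ _ _

theorem contDiff_gram {m k : ℕ} {Φ : Pt d → ℝ} (hΦ : ContDiff ℝ k Φ) (κ : ℝ) (n : ℕ) :
    ContDiff ℝ k (gram m Φ κ : Pt d × (Fin n → Pt d) → _) := by
  unfold gram
  refine ContDiff.sum fun j _ => ?_
  have hpt : ContDiff ℝ k fun q : Pt d × (Fin n → Pt d) => q.2 j := by fun_prop
  have hvec : ContDiff ℝ k fun q : Pt d × (Fin n → Pt d) => polyVec d m (q.2 j) :=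
    (contDiff_polyVec d m).comp hpt
  refine ContDiff.smul (hΦ.comp (by fun_prop)) ?_
  exact ContDiff.smulRight ((innerSL ℝ).contDiff.comp hvec) hvec

/-- Operator inversion is smooth at invertible operators. Regularity jointly in the point and the
sites is what permits compactness over configurations. -/
theorem contDiffAt_shape {m k : ℕ} {Φ : Pt d → ℝ} (hΦ : ContDiff ℝ k Φ) (κ : ℝ) {n : ℕ}
    (j : Fin n) {q : Pt d × (Fin n → Pt d)} (hq : (gram m Φ κ q).IsInvertible) :
    ContDiffAt ℝ k (shape m Φ κ j) q := by
  unfold shape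
  have hpt : ContDiff ℝ k fun q : Pt d × (Fin n → Pt d) => q.2 j := by fun_prop
  refine ContDiffAt.mul (hΦ.comp (by fun_prop)).contDiffAt ?_
  refine ContDiffAt.inner ℝ ((contDiff_polyVec d m).comp contDiff_fst).contDiffAt ?_
  refine ContDiffAt.clm_apply ?_ ((contDiff_polyVec d m).comp hpt).contDiffAt
  exact (hq.contDiffAt_map_inverse).comp q (contDiff_gram hΦ κ n).contDiffAt

/-- Representation of the moving least squares approximation near `x₀` by the shape functions of
those data sites `x₀ + σ • z j` that carry weight. -/
theorem mls_eq_sum_shape {m : ℕ} {Φ : Pt d → ℝ} (hΦ : ∀ x, 0 ≤ Φ x) {δ κ σ : ℝ} (hσ : σ ≠ 0)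
    {X : Finset (Pt d)} {x₀ ξ : Pt d} {n : ℕ} {z : Fin n → Pt d}
    (hsum : ∀ g : Pt d → ℝ, ∑ y ∈ X, g y * Φ (δ⁻¹ • (x₀ + σ • ξ - y)) =
      ∑ j, g (x₀ + σ • z j) * Φ (κ • (ξ - z j)))
    (hinv : (gram m Φ κ (ξ, z)).IsInvertible) (f : Pt d → ℝ) :
    mls m Φ δ X f (x₀ + σ • ξ) = ∑ j, f (x₀ + σ • z j) * shape m Φ κ j (ξ, z) := by
  set G := gram m Φ κ (ξ, z) with hG
  set b : Coeff d m := ∑ j, (Φ (κ • (ξ - z j)) * f (x₀ + σ • z j)) • polyVec d m (z j) with hb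
  set v : Coeff d m := G.inverse b with hv
  have hGv : G v = b := hinv.self_apply_inverse b
  obtain ⟨p₀, hp₀, hp₀e⟩ := exists_polyEval_eq_inner v
  obtain ⟨p, hp, hpe⟩ := exists_polyEval_affine p₀ hp₀ (-(σ⁻¹ • x₀)) σ⁻¹
  have hpe' : ∀ w, polyEval p (x₀ + σ • w) = inner ℝ v (polyVec d m w) := by
    intro w
    rw [hpe, smul_add, smul_smul, inv_mul_cancel₀ hσ, one_smul, neg_add_cancel_left, hp₀e]
  have hmls : mls m Φ δ X f (x₀ + σ • ξ) = polyEval p (x₀ + σ • ξ) := by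
    refine mls_eq_of_orthogonal hΦ hp (fun q hq => ?_) fun q hq h => ?_
    · obtain ⟨q', hq', hqe⟩ := exists_polyEval_affine q hq x₀ σ
      obtain ⟨u, hu⟩ := exists_inner_eq_polyEval q' hq'
      rw [hsum (fun y => (f y - polyEval p y) * polyEval q y)]
      have h1 : inner ℝ u (b - G v) = 0 := by rw [hGv, sub_self, inner_zero_right]
      rw [inner_sub_right, hG, inner_gram, hb, inner_sum, ← Finset.sum_sub_distrib] at h1
      rw [← h1]
      refine Finset.sum_congr rfl fun j _ => ?_
      rw [hpe', ← hqe, hu, real_inner_smul_right]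
      ring
    · obtain ⟨q', hq', hqe⟩ := exists_polyEval_affine q hq x₀ σ
      obtain ⟨u, hu⟩ := exists_inner_eq_polyEval q' hq'
      rw [hsum (fun y => polyEval q y ^ 2)] at h
      rw [Finset.sum_eq_zero_iff_of_nonneg
        (fun j _ => mul_nonneg (sq_nonneg _) (hΦ _))] at h
      have hGu : G u = 0 := by
        rw [hG, gram_apply]
        refine Finset.sum_eq_zero fun j hj => ?_
        have := h j hj
        rw [← hqe, hu] at this
        rcases mul_eq_zero.1 this with h0 | h0
        · rw [pow_eq_zero_iff two_ne_zero] at h0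
          rw [h0, mul_zero, zero_smul]
        · rw [h0, zero_mul, zero_smul]
      have hu0 : u = 0 := by
        have := hinv.inverse_apply_self u
        rw [hGu, map_zero] at this
        exact this.symm
      rw [← hqe, hu, hu0, inner_zero_left]
  rw [hmls, hpe', hv, hb, map_sum, sum_inner]
  refine Finset.sum_congr rfl fun j _ => ?_
  rw [map_smul, real_inner_smul_left, shape, real_inner_comm]
  ring

/-- The shape functions reproduce polynomials. -/
theorem sum_shape_polyEval {m : ℕ} {Φ : Pt d → ℝ} {κ : ℝ} (x₀ : Pt d) (σ : ℝ) {ξ : Pt d} {n : ℕ}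
    {z : Fin n → Pt d} (hinv : (gram m Φ κ (ξ, z)).IsInvertible)
    (p : MvPolynomial (Fin d) ℝ) (hp : p.totalDegree ≤ m) :
    ∑ j, polyEval p (x₀ + σ • z j) * shape m Φ κ j (ξ, z) = polyEval p (x₀ + σ • ξ) := by
  obtain ⟨q, hq, hqe⟩ := exists_polyEval_affine p hp x₀ σ
  obtain ⟨u, hu⟩ := exists_inner_eq_polyEval q hq
  rw [← hqe, hu]
  have h1 := hinv.inverse_apply_self u
  conv_rhs => rw [← h1, gram_apply, map_sum, sum_inner]
  refine Finset.sum_congr rfl fun j _ => ?_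
  rw [map_smul, real_inner_smul_left, shape, real_inner_comm, ← hqe, hu]
  ring

end LeastSquares

/-! ### Compactness: uniform lower bounds, invertibility and bounds on shape functions. -/

section Coercivity

variable {d : ℕ}

/-- Uniformly in the normalized polynomial and in the unit ball considered, a polynomial is bounded
away from zero on a small ball. -/
theorem exists_uniform_lower_bound (d m : ℕ) (ρ : ℝ) :
    ∃ ε : ℝ, 0 < ε ∧ ∃ c : ℝ, 0 < c ∧ ∀ v : Coeff d m, ‖v‖ = 1 → ∀ w : Pt d, ‖w‖ ≤ ρ →
      ∃ ζ ∈ Metric.ball w 1, ∀ z, ‖z - ζ‖ ≤ ε → c ≤ |inner ℝ v (polyVec d m z)| := by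
  have hK : IsCompact (Metric.sphere (0 : Coeff d m) 1 ×ˢ Metric.closedBall (0 : Pt d) ρ) :=
    (isCompact_sphere _ _).prod (isCompact_closedBall _ _)
  have key : ∃ ε : ℝ, 0 < ε ∧ ∃ c : ℝ, 0 < c ∧
      ∀ q ∈ Metric.sphere (0 : Coeff d m) 1 ×ˢ Metric.closedBall (0 : Pt d) ρ,
      ∃ ζ ∈ Metric.ball q.2 1, ∀ z, ‖z - ζ‖ ≤ ε → c ≤ |inner ℝ q.1 (polyVec d m z)| := by
    -- The property passes to finite unions by taking minima, so by compactness it is enough to fix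
    -- one `ζ` near each `(v₀, w₀)`.
    refine hK.induction_on (p := fun s => ∃ ε : ℝ, 0 < ε ∧ ∃ c : ℝ, 0 < c ∧ ∀ q ∈ s,
      ∃ ζ ∈ Metric.ball q.2 1, ∀ z, ‖z - ζ‖ ≤ ε → c ≤ |inner ℝ q.1 (polyVec d m z)|) ?_ ?_ ?_ ?_
    · exact ⟨1, one_pos, 1, one_pos, fun q hq => hq.elim⟩
    · rintro s t hst ⟨ε, hε, c, hc, h⟩
      exact ⟨ε, hε, c, hc, fun q hq => h q (hst hq)⟩
    · rintro s t ⟨ε, hε, c, hc, h⟩ ⟨ε', hε', c', hc', h'⟩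
      refine ⟨min ε ε', lt_min hε hε', min c c', lt_min hc hc', fun q hq => ?_⟩
      rcases hq with hq | hq
      · obtain ⟨ζ, hζ, hz⟩ := h q hq
        exact ⟨ζ, hζ, fun z hz' => (min_le_left _ _).trans (hz z (hz'.trans (min_le_left _ _)))⟩
      · obtain ⟨ζ, hζ, hz⟩ := h' q hq
        exact ⟨ζ, hζ, fun z hz' => (min_le_right _ _).trans (hz z (hz'.trans (min_le_right _ _)))⟩
    · rintro ⟨v₀, w₀⟩ ⟨hv₀, -⟩
      have hv₀' : v₀ ≠ 0 := by
        rintro rfl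
        simp at hv₀
      obtain ⟨ζ, hζ, hne⟩ := exists_inner_polyVec_ne_zero hv₀' w₀ one_pos
      have hcont : Continuous fun a : Coeff d m × Pt d => |inner ℝ a.1 (polyVec d m a.2)| :=
        (continuous_fst.inner ((contDiff_polyVec d m (n := 0)).continuous.comp
          continuous_snd)).abs
      set c := |inner ℝ v₀ (polyVec d m ζ)| with hc
      have hcpos : 0 < c := abs_pos.2 hne
      have hev : ∀ᶠ a in 𝓝 (v₀, ζ), c / 2 < |inner ℝ a.1 (polyVec d m a.2)| :=
        hcont.continuousAt.eventually (lt_mem_nhds (by simpa [← hc] using half_lt_self hcpos))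
      rw [nhds_prod_eq, Filter.eventually_prod_iff] at hev
      obtain ⟨pa, hpa, pb, hpb, hab⟩ := hev
      obtain ⟨ε, hε, hball⟩ := Metric.eventually_nhds_iff_ball.1 hpb
      have hpa' : ∀ᶠ q : Coeff d m × Pt d in 𝓝 (v₀, w₀), pa q.1 :=
        (continuous_fst.tendsto (v₀, w₀)).eventually hpa
      have hζ' : ∀ᶠ q : Coeff d m × Pt d in 𝓝 (v₀, w₀), dist ζ q.2 < 1 :=
        (Continuous.tendsto (continuous_const.dist continuous_snd) (v₀, w₀)).eventually
          (gt_mem_nhds hζ)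
      refine ⟨{q | pa q.1 ∧ dist ζ q.2 < 1}, mem_nhdsWithin_of_mem_nhds (hpa'.and hζ'), ε / 2,
        half_pos hε, c / 2, half_pos hcpos, ?_⟩
      · rintro ⟨v, w⟩ ⟨hv, hw⟩
        refine ⟨ζ, hw, fun z hz => (hab hv (hball z ?_)).le⟩
        rw [Metric.mem_ball, dist_eq_norm]
        linarith
  obtain ⟨ε, hε, c, hc, h⟩ := key
  exact ⟨ε, hε, c, hc, fun v hv w hw => h (v, w) ⟨by simpa using hv, by simpa using hw⟩⟩

theorem isInvertible_of_coercive {V : Type*} [NormedAddCommGroup V] [InnerProductSpace ℝ V]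
    [FiniteDimensional ℝ V] {G : V →L[ℝ] V} {c : ℝ} (hc : 0 < c)
    (h : ∀ v : V, ‖v‖ = 1 → c ≤ inner ℝ v (G v)) : G.IsInvertible := by
  have hinj : Function.Injective (G : V →ₗ[ℝ] V) := by
    rw [← LinearMap.ker_eq_bot, LinearMap.ker_eq_bot']
    intro v hv
    by_contra hne
    have h1 := h (‖v‖⁻¹ • v) (norm_smul_inv_norm (𝕜 := ℝ) hne)
    have h2 : G v = 0 := hv
    rw [map_smul, h2, smul_zero, inner_zero_right] at h1
    linarith
  refine ⟨(LinearEquiv.ofInjectiveEndo (G : V →ₗ[ℝ] V) hinj).toContinuousLinearEquiv, ?_⟩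
  ext v
  rfl

theorem isOpen_isInvertible_gram {m k : ℕ} {Φ : Pt d → ℝ} (hΦ : ContDiff ℝ k Φ) (κ : ℝ) (n : ℕ) :
    IsOpen {q : Pt d × (Fin n → Pt d) | (gram m Φ κ q).IsInvertible} :=
  (ContinuousLinearEquiv.isOpen (𝕜 := ℝ) (E := Coeff d m) (F := Coeff d m)).preimage
    (contDiff_gram hΦ κ n).continuous

theorem contDiffOn_shape {m k : ℕ} {Φ : Pt d → ℝ} (hΦ : ContDiff ℝ k Φ) (κ : ℝ) {n : ℕ}
    (j : Fin n) :
    ContDiffOn ℝ k (shape m Φ κ j) {q | (gram m Φ κ q).IsInvertible} :=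
  fun _ hq => (contDiffAt_shape hΦ κ j hq).contDiffWithinAt

/-- The derivatives of the shape functions are bounded uniformly over all bounded configurations
with uniformly coercive normal equations. -/
theorem exists_bound_iteratedFDeriv_shape {m k : ℕ} {Φ : Pt d → ℝ} (hΦ : ContDiff ℝ k Φ)
    (κ R : ℝ) {c : ℝ} (hc : 0 < c) (n : ℕ) {l : ℕ} (hl : l ≤ k) :
    ∃ C : ℝ, 0 ≤ C ∧ ∀ z : Fin n → Pt d, (∀ j, ‖z j‖ ≤ R) →
      (∀ v : Coeff d m, ‖v‖ = 1 → c ≤ inner ℝ v (gram m Φ κ (0, z) v)) →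
      ∀ j, ‖iteratedFDeriv ℝ l (shape m Φ κ j) (0, z)‖ ≤ C := by
  -- Coercivity with a fixed `c` is a closed condition, whereas invertibility is only an open one;
  -- this is why `K` is compact.
  set K : Set (Fin n → Pt d) := Set.pi univ (fun _ => Metric.closedBall 0 R) ∩
    {z | ∀ v : Coeff d m, ‖v‖ = 1 → c ≤ inner ℝ v (gram m Φ κ (0, z) v)} with hKdef
  have hK : IsCompact K := by
    refine (isCompact_univ_pi fun _ => isCompact_closedBall _ _).inter_right ?_
    simp only [Set.ofPred_forall]
    refine isClosed_iInter fun v => isClosed_iInter fun _ => ?_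
    refine isClosed_le continuous_const (continuous_const.inner ?_)
    have : Continuous fun z : Fin n → Pt d => gram m Φ κ ((0 : Pt d), z) :=
      (contDiff_gram hΦ κ n).continuous.comp (by fun_prop)
    exact this.clm_apply continuous_const
  have hb : ∀ j : Fin n, ∃ C : ℝ, ∀ z ∈ K, ‖iteratedFDeriv ℝ l (shape m Φ κ j) (0, z)‖ ≤ C := by
    intro j
    refine hK.exists_bound_of_continuousOn fun z hz => ContinuousAt.continuousWithinAt ?_
    have h1 : ContinuousAt (iteratedFDeriv ℝ l (shape m Φ κ j)) (0, z) :=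
      (contDiffAt_shape hΦ κ j (isInvertible_of_coercive hc hz.2)).continuousAt_iteratedFDeriv
        (by exact_mod_cast hl)
    exact ContinuousAt.comp (f := fun z : Fin n → Pt d => ((0 : Pt d), z)) h1 (by fun_prop)
  choose C hC using hb
  refine ⟨∑ j, |C j|, Finset.sum_nonneg fun _ _ => abs_nonneg _, fun z hz hcoer j => ?_⟩
  refine (hC j z ⟨fun i _ => by simpa using hz i, hcoer⟩).trans ((le_abs_self _).trans ?_)
  exact Finset.single_le_sum (f := fun j => |C j|) (fun _ _ => abs_nonneg _) (Finset.mem_univ j)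

/-- A separated family in a ball has a bounded number of members. -/
theorem exists_card_bound (d : ℕ) (R : ℝ) {s : ℝ} (hs : 0 < s) :
    ∃ N : ℕ, ∀ n : ℕ, ∀ z : Fin n → Pt d, (∀ j, ‖z j‖ ≤ R) →
      (∀ i j, i ≠ j → s ≤ dist (z i) (z j)) → n ≤ N := by
  -- Each covering ball of radius `s / 2` contains at most one member of the family.
  obtain ⟨t, -, htf, ht⟩ := (isCompact_closedBall (0 : Pt d) R).finite_cover_balls
    (e := s / 2) (half_pos hs)
  refine ⟨htf.toFinset.card, fun n z hz hsep => ?_⟩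
  have hex : ∀ j, ∃ a ∈ t, z j ∈ Metric.ball a (s / 2) := by
    intro j
    have := ht (show z j ∈ Metric.closedBall 0 R by simpa using hz j)
    simpa using this
  choose a ha hza using hex
  have hinj : Function.Injective a := by
    intro i j hij
    by_contra hne
    have h1 := hsep i j hne
    have h2 := Metric.mem_ball.1 (hza i)
    have h3 := Metric.mem_ball'.1 (hza j)
    rw [hij] at h2
    linarith [dist_triangle (z i) (a j) (z j)]
  have := Finset.card_le_card_of_injOn (s := Finset.univ) (t := htf.toFinset) a
    (fun j _ => by simpa using ha j) (fun i _ j _ h => hinj h)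
  simpa using this

end Coercivity

/-! ### Derivatives under affine substitution. -/

section AffineComposition

variable {E F G : Type*} [NormedAddCommGroup E] [NormedSpace ℝ E] [NormedAddCommGroup F]
  [NormedSpace ℝ F] [NormedAddCommGroup G] [NormedSpace ℝ G]

/-- Applied with `L` equal to `σ⁻¹` times an embedding, this is the source of the loss `σ⁻¹ ^ l`. -/
theorem norm_iteratedFDeriv_comp_affine_le {f : E → F} {s : Set E} (hs : IsOpen s) {l : ℕ}
    (hf : ContDiffOn ℝ l f s) (L : G →L[ℝ] E) (a : E) {x : G} (hx : L x + a ∈ s) :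
    ‖iteratedFDeriv ℝ l (fun y => f (L y + a)) x‖ ≤ ‖iteratedFDeriv ℝ l f (L x + a)‖ * ‖L‖ ^ l := by
  set s' : Set E := (fun y => y + a) ⁻¹' s with hs'
  have hs'o : IsOpen s' := hs.preimage (by fun_prop)
  have hf' : ContDiffOn ℝ l (fun y => f (y + a)) s' :=
    hf.comp (contDiff_id.add contDiff_const).contDiffOn fun y hy => hy
  have hLo : IsOpen (L ⁻¹' s') := hs'o.preimage L.continuous
  have h := L.iteratedFDerivWithin_comp_right (n := l) hf' hs'o.uniqueDiffOn hLo.uniqueDiffOn hx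
    (i := l) le_rfl
  rw [iteratedFDerivWithin_of_isOpen _ hLo hx, iteratedFDerivWithin_of_isOpen _ hs'o hx,
    iteratedFDeriv_comp_add_right] at h
  have h' : iteratedFDeriv ℝ l (fun y => f (L y + a)) x =
    (iteratedFDeriv ℝ l f (L x + a)).compContinuousLinearMap fun _ => L := h
  rw [h']
  refine (ContinuousMultilinearMap.norm_compContinuousLinearMap_le _ _).trans ?_
  simp

end AffineComposition

/-! ### Sign and lower bounds of the weight. -/

section Weight

variable {d k : ℕ} {Φ : Pt d → ℝ}

theorem IsWeight.eq_zero (hΦ : IsWeight k Φ) {x : Pt d} (hx : 1 < ‖x‖) : Φ x = 0 := by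
  refine image_eq_zero_of_notMem_tsupport fun h => ?_
  rw [hΦ.tsupport_eq] at h
  exact absurd (by simpa using h) (not_le.2 hx)

theorem IsWeight.nonneg (hΦ : IsWeight k Φ) (x : Pt d) : 0 ≤ Φ x := by
  by_cases hx : 1 < ‖x‖
  · exact (hΦ.eq_zero hx).ge
  · have hcl : x ∈ closure (Metric.ball (0 : Pt d) 1) := by
      rw [closure_ball _ one_ne_zero]
      simpa using hx
    have hsub : Metric.ball (0 : Pt d) 1 ⊆ {x | 0 ≤ Φ x} := fun y hy => (hΦ.pos y hy).le
    exact closure_minimal hsub (isClosed_le continuous_const hΦ.contDiff.continuous) hcl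

theorem IsWeight.exists_lower_bound (hΦ : IsWeight k Φ) :
    ∃ c : ℝ, 0 < c ∧ ∀ x : Pt d, ‖x‖ ≤ 1 / 2 → c ≤ Φ x := by
  obtain ⟨x₀, hx₀, hmin⟩ := (isCompact_closedBall (0 : Pt d) (1 / 2)).exists_isMinOn
    ⟨0, by simp⟩ hΦ.contDiff.continuous.continuousOn
  refine ⟨Φ x₀, hΦ.pos x₀ ?_, fun x hx => hmin (by simpa using hx)⟩
  have : ‖x₀‖ ≤ 1 / 2 := by simpa using hx₀
  rw [mem_ball_zero_iff]
  linarith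

end Weight

/-! ### Geometry of the data sites and uniform coercivity. -/

section DataSets

variable {d : ℕ} {Ω : Set (Pt d)} {X : Finset (Pt d)}

theorem infDist_le_fillDist (hΩb : Bornology.IsBounded Ω) (hX : X.Nonempty)
    (hXΩ : (X : Set (Pt d)) ⊆ Ω) {x : Pt d} (hx : x ∈ Ω) : Metric.infDist x (X : Set (Pt d)) ≤ fillDist Ω X := by
  refine le_csSup ?_ (mem_image_of_mem _ hx)
  obtain ⟨y, hy⟩ := hX
  refine ⟨Metric.diam Ω, ?_⟩
  rintro _ ⟨x', hx', rfl⟩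
  exact (Metric.infDist_le_dist_of_mem (Finset.mem_coe.2 hy)).trans
    (Metric.dist_le_diam_of_mem hΩb hx' (hXΩ hy))

theorem exists_dist_le_fillDist (hΩb : Bornology.IsBounded Ω) (hX : X.Nonempty)
    (hXΩ : (X : Set (Pt d)) ⊆ Ω) {x : Pt d} (hx : x ∈ Ω) : ∃ y ∈ X, dist x y ≤ fillDist Ω X := by
  obtain ⟨y, hy, h⟩ := X.finite_toSet.isCompact.exists_infDist_eq_dist (by simpa using hX) x
  exact ⟨y, hy, h ▸ infDist_le_fillDist hΩb hX hXΩ hx⟩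

/-- In positive dimension a nonempty open set is infinite, so the finite set `X` misses a point of
it. -/
theorem fillDist_pos (hd : 0 < d) (hΩo : IsOpen Ω) (hΩn : Ω.Nonempty)
    (hΩb : Bornology.IsBounded Ω) (hX : X.Nonempty) (hXΩ : (X : Set (Pt d)) ⊆ Ω) :
    0 < fillDist Ω X := by
  have : Nonempty (Fin d) := ⟨⟨0, hd⟩⟩
  obtain ⟨x, hx⟩ := hΩn
  have := Module.punctured_nhds_neBot ℝ (Pt d) x
  have hinf : Ω.Infinite := infinite_of_mem_nhds x (hΩo.mem_nhds hx)
  obtain ⟨y, hyΩ, hyX⟩ := hinf.exists_notMem_finset X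
  refine lt_of_lt_of_le ?_ (infDist_le_fillDist hΩb hX hXΩ hyΩ)
  exact (X.finite_toSet.isClosed.notMem_iff_infDist_pos (by simpa using hX)).1 (by simpa using hyX)

/-- Separates the rescaled sites by a fixed amount, which bounds their number. -/
theorem QuasiUniform.fillDist_le {cq : ℝ} (hcq : 0 ≤ cq) (hX : QuasiUniform Ω cq X) {y z : Pt d}
    (hy : y ∈ X) (hz : z ∈ X) (hyz : y ≠ z) : fillDist Ω X ≤ cq * (dist y z / 2) := by
  refine hX.fill_le_sep.trans (mul_le_mul_of_nonneg_left ?_ hcq)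
  unfold sepRadius
  have : sInf {t : ℝ | ∃ y ∈ X, ∃ z ∈ X, y ≠ z ∧ t = dist y z} ≤ dist y z := by
    refine csInf_le ⟨0, ?_⟩ ⟨y, hy, z, hz, hyz, rfl⟩
    rintro _ ⟨y, -, z, -, -, rfl⟩
    exact dist_nonneg
  linarith

/-- The data sites near `x₀` in rescaled coordinates, and localization of the weighted sums. -/
theorem exists_local_configuration {k : ℕ} {Φ : Pt d → ℝ} (hΦ : IsWeight k Φ) (X : Finset (Pt d))
    (x₀ : Pt d) {σ δ : ℝ} (hσ : 0 < σ) (hδ : 0 < δ) :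
    ∃ (n : ℕ) (z : Fin n → Pt d), Function.Injective z ∧ (∀ j, x₀ + σ • z j ∈ X) ∧
      (∀ j, ‖z j‖ ≤ 2 * δ / σ) ∧
      (∀ y ∈ X, ‖y - x₀‖ ≤ 2 * δ → ∃ j, y = x₀ + σ • z j) ∧
      ∀ ξ : Pt d, ‖ξ‖ < δ / σ → ∀ g : Pt d → ℝ,
        ∑ y ∈ X, g y * Φ (δ⁻¹ • (x₀ + σ • ξ - y)) =
          ∑ j, g (x₀ + σ • z j) * Φ ((σ / δ) • (ξ - z j)) := by
  classical
  -- A site carrying weight at a point less than `δ` from `x₀` lies within `2 * δ` of `x₀`. One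
  -- index set thus serves a whole neighbourhood of `x₀`.
  set Y := X.filter fun y => ‖y - x₀‖ ≤ 2 * δ with hY
  let e := Y.equivFin
  let z : Fin Y.card → Pt d := fun j => σ⁻¹ • ((e.symm j : Pt d) - x₀)
  have hz : ∀ j, x₀ + σ • z j = e.symm j := fun j => by
    simp only [z, smul_smul, mul_inv_cancel₀ hσ.ne', one_smul, add_sub_cancel]
  have hmem : ∀ j, (e.symm j : Pt d) ∈ X ∧ ‖(e.symm j : Pt d) - x₀‖ ≤ 2 * δ := fun j =>
    Finset.mem_filter.1 (e.symm j).2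
  refine ⟨Y.card, z, fun i j hij => ?_, fun j => ?_, fun j => ?_, fun y hy hyd => ?_,
    fun ξ hξ g => ?_⟩
  · refine e.symm.injective (Subtype.ext ?_)
    rw [← hz, ← hz, hij]
  · rw [hz]; exact (hmem j).1
  · simp only [z, norm_smul, norm_inv, Real.norm_eq_abs, abs_of_pos hσ]
    rw [inv_mul_eq_div]
    exact div_le_div_of_nonneg_right (hmem j).2 hσ.le
  · refine ⟨e ⟨y, Finset.mem_filter.2 ⟨hy, hyd⟩⟩, ?_⟩
    rw [hz, Equiv.symm_apply_apply]
  · have h1 : ∑ y ∈ X, g y * Φ (δ⁻¹ • (x₀ + σ • ξ - y)) =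
        ∑ y ∈ Y, g y * Φ (δ⁻¹ • (x₀ + σ • ξ - y)) := by
      symm
      refine Finset.sum_subset (Finset.filter_subset _ _) fun y hy hyY => ?_
      have hfar : 2 * δ < ‖y - x₀‖ := by
        by_contra hcon
        exact hyY (Finset.mem_filter.2 ⟨hy, not_lt.1 hcon⟩)
      have hσξ : ‖σ • ξ‖ < δ := by
        rw [norm_smul, Real.norm_eq_abs, abs_of_pos hσ, mul_comm]
        exact (lt_div_iff₀ hσ).1 hξ
      have hn : δ < ‖x₀ + σ • ξ - y‖ := by
        have : y - x₀ = σ • ξ - (x₀ + σ • ξ - y) := by abel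
        rw [this] at hfar
        linarith [norm_sub_le (σ • ξ) (x₀ + σ • ξ - y)]
      rw [hΦ.eq_zero, mul_zero]
      rw [norm_smul, norm_inv, Real.norm_eq_abs, abs_of_pos hδ, inv_mul_eq_div]
      exact (one_lt_div hδ).2 hn
    rw [h1, ← Finset.sum_coe_sort Y, ← e.symm.sum_comp]
    refine Finset.sum_congr rfl fun j _ => ?_
    rw [hz j]
    congr 2
    rw [← hz j, add_sub_add_left_eq_sub, ← smul_sub, smul_smul, inv_mul_eq_div]

/-- For large support radii and small fill distances the normal equations are coercive, uniformly
in the data sites and up to the boundary. -/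
theorem exists_uniform_coercivity {k : ℕ} (m : ℕ) {Φ : Pt d → ℝ} (hΦ : IsWeight k Φ)
    (hΩo : IsOpen Ω) (hΩn : Ω.Nonempty) (hΩc : Convex ℝ Ω) (hΩb : Bornology.IsBounded Ω) :
    ∃ ν₀ : ℝ, 1 < ν₀ ∧ ∃ H : ℝ, 0 < H ∧ ∃ M : ℝ, 0 < M ∧ ∃ c : ℝ, 0 < c ∧
      ∀ ν : ℝ, ν₀ ≤ ν → ∀ X : Finset (Pt d), X.Nonempty → (X : Set (Pt d)) ⊆ Ω →
        0 < fillDist Ω X → fillDist Ω X ≤ H → ∀ x₀ ∈ closure Ω,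
        ∀ (n : ℕ) (z : Fin n → Pt d),
        (∀ y ∈ X, ‖y - x₀‖ ≤ 2 * (ν * fillDist Ω X) → ∃ j, y = x₀ + (M * fillDist Ω X) • z j) →
        ∀ v : Coeff d m, ‖v‖ = 1 → c ≤ inner ℝ v (gram m Φ (M / ν) (0, z) v) := by
  obtain ⟨a, ha⟩ := hΩn
  obtain ⟨r, hr, hball⟩ := Metric.isOpen_iff.1 hΩo a ha
  set D := Metric.diam (closure Ω) with hD
  have hD0 : 0 ≤ D := Metric.diam_nonneg
  set ρ := D / r with hρ
  have hρ0 : 0 ≤ ρ := by positivity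
  obtain ⟨ε, hε, c₀, hc₀, hlow⟩ := exists_uniform_lower_bound d m ρ
  obtain ⟨φ, hφ, hΦlow⟩ := hΦ.exists_lower_bound
  -- With `σ = M * h` one has `σ * ε = h`: in rescaled coordinates the fill distance is exactly `ε`.
  set M := ε⁻¹ with hM
  have hM0 : 0 < M := inv_pos.2 hε
  have hMε : M * ε = 1 := inv_mul_cancel₀ hε.ne'
  -- The site found below satisfies `‖z j‖ ≤ ρ + 1 + ε`; this `ν₀` puts it in the half ball where `Φ
  -- ≥ φ`. The bound `r / M` on `h` ensures `σ ≤ r`.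
  refine ⟨2 + 2 * M * (ρ + 1 + ε), by nlinarith [mul_nonneg hM0.le hρ0], r / M, by positivity, M,
    hM0, φ * c₀ ^ 2, by positivity, ?_⟩
  intro ν hν X hX hXΩ hh hhH x₀ hx₀ n z hz v hv
  set h := fillDist Ω X with hhdef
  have hB : 0 < M * (ρ + 1 + ε) := by positivity
  have hν0 : 0 < ν := by linarith
  have hσ : 0 < M * h := by positivity
  have hσr : M * h ≤ r := by
    rw [mul_comm]; exact (le_div_iff₀ hM0).1 hhH
  set w : Pt d := r⁻¹ • (a - x₀) with hw
  have hwρ : ‖w‖ ≤ ρ := by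
    rw [hw, norm_smul, norm_inv, Real.norm_eq_abs, abs_of_pos hr, hρ, inv_mul_eq_div]
    refine div_le_div_of_nonneg_right ?_ hr.le
    rw [← dist_eq_norm]
    exact Metric.dist_le_diam_of_mem hΩb.closure (subset_closure ha) hx₀
  obtain ⟨ζ, hζ, hζlow⟩ := hlow v hv w hwρ
  have hζw : ‖ζ - w‖ < 1 := by simpa [dist_eq_norm] using hζ
  have hζn : ‖ζ‖ ≤ ρ + 1 := by
    have := norm_add_le (ζ - w) w
    rw [sub_add_cancel] at this
    linarith
  -- The point `x₀ + r • ζ` lies in the ball of radius `r` about `a`. Contracting it towards `x₀` by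
  -- the factor `σ / r ≤ 1` stays in `Ω` by convexity, even if `x₀` is a boundary point.
  have hmem : x₀ + (M * h) • ζ ∈ Ω := by
    have h1 : x₀ + r • ζ ∈ interior Ω := by
      rw [hΩo.interior_eq]
      refine hball ?_
      rw [Metric.mem_ball, dist_eq_norm]
      have : x₀ + r • ζ - a = r • (ζ - w) := by
        rw [hw, smul_sub, smul_smul, mul_inv_cancel₀ hr.ne', one_smul]
        abel
      rw [this, norm_smul, Real.norm_eq_abs, abs_of_pos hr]
      nlinarith
    have h2 := hΩc.combo_closure_interior_mem_interior hx₀ h1 (a := 1 - M * h / r)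
      (b := M * h / r) (by rw [sub_nonneg]; exact (div_le_one hr).2 hσr) (by positivity) (by ring)
    have h3 : (1 - M * h / r) • x₀ + (M * h / r) • (x₀ + r • ζ) = x₀ + (M * h) • ζ := by
      rw [smul_add, smul_smul, div_mul_cancel₀ _ hr.ne', sub_smul, one_smul]
      abel
    rw [h3] at h2
    exact interior_subset h2
  obtain ⟨y, hyX, hy⟩ := exists_dist_le_fillDist hΩb hX hXΩ hmem
  have hyx₀ : ‖y - x₀‖ ≤ M * h * (ρ + 1 + ε) := by
    have h1 : y - x₀ = (M * h) • ζ - (x₀ + (M * h) • ζ - y) := by abel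
    rw [h1]
    refine (norm_sub_le _ _).trans ?_
    rw [norm_smul, Real.norm_eq_abs, abs_of_pos hσ, ← dist_eq_norm]
    have h2 : M * h * ε = h := by rw [mul_right_comm, hMε, one_mul]
    have h3 : M * h * ‖ζ‖ ≤ M * h * (ρ + 1) := by gcongr
    have h4 : dist (x₀ + (M * h) • ζ) y ≤ h := hy
    linarith [mul_add (M * h) (ρ + 1) ε]
  obtain ⟨j, hj⟩ := hz y hyX (hyx₀.trans (by nlinarith))
  have hzj : (M * h) * ‖z j‖ ≤ M * h * (ρ + 1 + ε) := by
    rw [hj, add_sub_cancel_left, norm_smul, Real.norm_eq_abs, abs_of_pos hσ] at hyx₀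
    exact hyx₀
  have hzj' : ‖z j‖ ≤ ρ + 1 + ε := le_of_mul_le_mul_left hzj hσ
  have hzζ : ‖z j - ζ‖ ≤ ε := by
    rw [hj, dist_comm, dist_add_left, dist_eq_norm, ← smul_sub, norm_smul, Real.norm_eq_abs,
      abs_of_pos hσ] at hy
    refine le_of_mul_le_mul_left ?_ hσ
    rw [mul_right_comm M h ε, hMε, one_mul]
    exact hy
  have hin := hζlow _ hzζ
  have hwt : φ ≤ Φ ((M / ν) • (0 - z j)) := by
    refine hΦlow _ ?_
    rw [zero_sub, smul_neg, norm_neg, norm_smul, Real.norm_eq_abs, abs_of_pos (by positivity)]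
    rw [div_mul_eq_mul_div, div_le_iff₀ hν0]
    have : M * ‖z j‖ ≤ M * (ρ + 1 + ε) := by gcongr
    linarith
  rw [inner_gram]
  have hterm : ∀ i, Φ ((M / ν) • (0 - z i)) * inner ℝ v (polyVec d m (z i)) *
      inner ℝ v (polyVec d m (z i)) = Φ ((M / ν) • (0 - z i)) *
        |inner ℝ v (polyVec d m (z i))| ^ 2 := fun i => by rw [sq_abs]; ring
  simp only [hterm]
  refine le_trans ?_ (Finset.single_le_sum
    (f := fun i => Φ ((M / ν) • (0 - z i)) * |inner ℝ v (polyVec d m (z i))| ^ 2)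
    (fun i _ => mul_nonneg (hΦ.nonneg _) (sq_nonneg _)) (Finset.mem_univ j))
  gcongr
  exact hΦ.nonneg _

end DataSets

/-! ### The space `C^k` of the closure and its norm. -/

section Norms

variable {d : ℕ} {Ω : Set (Pt d)} {k : ℕ} {f : Pt d → ℝ}

theorem normCk_nonneg (Ω : Set (Pt d)) (k : ℕ) (f : Pt d → ℝ) : 0 ≤ normCk Ω k f := by
  refine Real.sSup_nonneg ?_
  rintro _ ⟨n, -, i, x, -, rfl⟩
  exact abs_nonneg _

theorem normCk_le {B : ℝ} (hB : 0 ≤ B)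
    (h : ∀ n ≤ k, ∀ x ∈ Ω, ∀ i : Fin n → Fin d, |partialDeriv i f x| ≤ B) : normCk Ω k f ≤ B := by
  refine Real.sSup_le ?_ hB
  rintro _ ⟨n, hn, i, x, hx, rfl⟩
  exact h n hn x hx i

theorem abs_partialDeriv_le_norm {n : ℕ} (i : Fin n → Fin d) (f : Pt d → ℝ) (x : Pt d) :
    |partialDeriv i f x| ≤ ‖iteratedFDeriv ℝ n f x‖ := by
  refine ((iteratedFDeriv ℝ n f x).le_opNorm _).trans ?_
  simp

/-- A real `sSup` is `0` on unbounded sets, so boundedness must be shown; it comes from the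
continuous extensions to the compact closure. -/
theorem MemCk.abs_partialDeriv_le (hΩb : Bornology.IsBounded Ω) (hf : MemCk Ω k f) {n : ℕ}
    (hn : n ≤ k) (i : Fin n → Fin d) {x : Pt d} (hx : x ∈ Ω) :
    |partialDeriv i f x| ≤ normCk Ω k f := by
  refine le_csSup ?_ ⟨n, hn, i, x, hx, rfl⟩
  have hb : ∀ (n : ℕ) (i : Fin n → Fin d), ∃ B : ℝ, n ≤ k → ∀ x ∈ Ω, |partialDeriv i f x| ≤ B := by
    intro n i
    by_cases hn : n ≤ k
    · obtain ⟨g, hg, hgeq⟩ := hf.2 n hn i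
      obtain ⟨B, hB⟩ := hΩb.isCompact_closure.exists_bound_of_continuousOn hg
      exact ⟨B, fun _ x hx => hgeq hx ▸ hB x (subset_closure hx)⟩
    · exact ⟨0, fun h => absurd h hn⟩
  choose B hB using hb
  refine ⟨∑ n ∈ Finset.range (k + 1), ∑ i : Fin n → Fin d, |B n i|, ?_⟩
  rintro _ ⟨n, hn, i, x, hx, rfl⟩
  calc |partialDeriv i f x| ≤ |B n i| := (hB n i hn x hx).trans (le_abs_self _)
    _ ≤ ∑ i : Fin n → Fin d, |B n i| :=
        Finset.single_le_sum (f := fun i => |B n i|) (fun _ _ => abs_nonneg _) (Finset.mem_univ i)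
    _ ≤ _ := Finset.single_le_sum (f := fun n => ∑ i : Fin n → Fin d, |B n i|)
        (fun _ _ => Finset.sum_nonneg fun _ _ => abs_nonneg _) (Finset.mem_range.2 (by omega))

theorem MemCk.norm_iteratedFDeriv_le (hΩb : Bornology.IsBounded Ω) (hf : MemCk Ω k f) {n : ℕ}
    (hn : n ≤ k) {x : Pt d} (hx : x ∈ Ω) :
    ‖iteratedFDeriv ℝ n f x‖ ≤ (d : ℝ) ^ n * normCk Ω k f :=
  norm_multilinear_le _ (normCk_nonneg _ _ _) fun i => hf.abs_partialDeriv_le hΩb hn i hx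

theorem MemCk.of_le (hf : MemCk Ω k f) {l : ℕ} (hl : l ≤ k) : MemCk Ω l f :=
  ⟨hf.1.of_le (by exact_mod_cast hl), fun n hn i => hf.2 n (hn.trans hl) i⟩

/-- The derivatives of `g` are their own continuous extensions. This is why MLS is analysed at all
points of the closure. -/
theorem MemCk.sub_of_contDiffAt (hΩo : IsOpen Ω) (hf : MemCk Ω k f) {g : Pt d → ℝ}
    (hg : ∀ x ∈ closure Ω, ContDiffAt ℝ k g x) : MemCk Ω k (f - g) := by
  refine ⟨hf.1.sub fun x hx => (hg x (subset_closure hx)).contDiffWithinAt, fun n hn i => ?_⟩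
  obtain ⟨u, hu, hueq⟩ := hf.2 n hn i
  have hnk : (n : WithTop ℕ∞) ≤ k := by exact_mod_cast hn
  refine ⟨fun x => u x - partialDeriv i g x, hu.sub fun x hx => ?_, fun x hx => ?_⟩
  · refine ContinuousAt.continuousWithinAt ?_
    have h1 := (hg x hx).continuousAt_iteratedFDeriv hnk
    exact (ContinuousMultilinearMap.apply ℝ (fun _ : Fin n => Pt d) ℝ
      (fun j => EuclideanSpace.single (i j) (1 : ℝ))).continuous.continuousAt.comp h1
  · simp only [partialDeriv]
    rw [iteratedFDeriv_sub_apply ((hf.1.contDiffAt (hΩo.mem_nhds hx)).of_le hnk)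
      ((hg x (subset_closure hx)).of_le hnk), hueq hx]
    rfl

end Norms

/-! ### The single-level error estimate. -/

section SingleLevel

variable {d : ℕ} {Ω : Set (Pt d)} {k m : ℕ} {Φ : Pt d → ℝ}

/-- Local representation of the moving least squares approximation by shape functions. -/
theorem eventually_mls_eq_sum_shape (hΦ : IsWeight k Φ) {X : Finset (Pt d)} {x₀ : Pt d} {σ δ κ : ℝ}
    (hσ : 0 < σ) (hδ : 0 < δ) {n : ℕ} {z : Fin n → Pt d}
    (hsum : ∀ ξ : Pt d, ‖ξ‖ < δ / σ → ∀ g : Pt d → ℝ,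
      ∑ y ∈ X, g y * Φ (δ⁻¹ • (x₀ + σ • ξ - y)) =
        ∑ j, g (x₀ + σ • z j) * Φ (κ • (ξ - z j)))
    (hinv : (gram m Φ κ (0, z)).IsInvertible) :
    ∀ᶠ x in 𝓝 x₀, (gram m Φ κ (σ⁻¹ • (x - x₀), z)).IsInvertible ∧ ∀ f : Pt d → ℝ,
      mls m Φ δ X f x = ∑ j, f (x₀ + σ • z j) * shape m Φ κ j (σ⁻¹ • (x - x₀), z) := by
  have hc1 : Continuous fun x : Pt d => ‖σ⁻¹ • (x - x₀)‖ := by fun_prop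
  have hc2 : Continuous fun x : Pt d => ((σ⁻¹ • (x - x₀), z) : Pt d × (Fin n → Pt d)) := by
    fun_prop
  have h1 : ∀ᶠ x in 𝓝 x₀, ‖σ⁻¹ • (x - x₀)‖ < δ / σ :=
    hc1.continuousAt.eventually (gt_mem_nhds (by simpa using div_pos hδ hσ))
  have h2 : ∀ᶠ x in 𝓝 x₀, (gram m Φ κ (σ⁻¹ • (x - x₀), z)).IsInvertible :=
    hc2.continuousAt.preimage_mem_nhds
      ((isOpen_isInvertible_gram hΦ.contDiff κ n).mem_nhds (by simpa using hinv))
  filter_upwards [h1, h2] with x hx1 hx2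
  refine ⟨hx2, fun f => ?_⟩
  have := mls_eq_sum_shape hΦ.nonneg hσ.ne' (hsum _ hx1) hx2 f
  rwa [smul_smul, mul_inv_cancel₀ hσ.ne', one_smul, add_sub_cancel] at this

theorem contDiffAt_shape_affine (hΦ : IsWeight k Φ) {κ : ℝ} {n : ℕ} {z : Fin n → Pt d}
    (hinv : (gram m Φ κ (0, z)).IsInvertible) (x₀ : Pt d) (σ : ℝ) (j : Fin n) :
    ContDiffAt ℝ k (fun x => shape m Φ κ j (σ⁻¹ • (x - x₀), z)) x₀ := by
  refine ContDiffAt.comp x₀ (f := fun x : Pt d => ((σ⁻¹ • (x - x₀), z) : Pt d × (Fin n → Pt d)))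
    (g := shape m Φ κ j) ?_ (by fun_prop)
  have : ((σ⁻¹ • (x₀ - x₀), z) : Pt d × (Fin n → Pt d)) = (0, z) := by simp
  rw [this]
  exact contDiffAt_shape hΦ.contDiff κ j hinv

theorem norm_iteratedFDeriv_shape_affine_le (hΦ : IsWeight k Φ) {κ : ℝ} {n : ℕ} {z : Fin n → Pt d}
    (hinv : (gram m Φ κ (0, z)).IsInvertible) (x₀ : Pt d) {σ : ℝ} (hσ : 0 < σ) (j : Fin n) {l : ℕ}
    (hl : l ≤ k) :
    ‖iteratedFDeriv ℝ l (fun x => shape m Φ κ j (σ⁻¹ • (x - x₀), z)) x₀‖ ≤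
      ‖iteratedFDeriv ℝ l (shape m Φ κ j) (0, z)‖ * σ⁻¹ ^ l := by
  let L : Pt d →L[ℝ] Pt d × (Fin n → Pt d) :=
    σ⁻¹ • ContinuousLinearMap.inl ℝ (Pt d) (Fin n → Pt d)
  have hL : ∀ x : Pt d, L x + (-(σ⁻¹ • x₀), z) = (σ⁻¹ • (x - x₀), z) := fun x => by
    simp [L, sub_eq_add_neg]
  have hL0 : L x₀ + (-(σ⁻¹ • x₀), z) = (0, z) := by rw [hL]; simp
  have h := norm_iteratedFDeriv_comp_affine_le (isOpen_isInvertible_gram (m := m) hΦ.contDiff κ n)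
    (l := l) ((contDiffOn_shape hΦ.contDiff κ j).of_le (by exact_mod_cast hl)) L
    (-(σ⁻¹ • x₀), z) (x := x₀) (by rw [hL0]; exact hinv)
  simp only [hL] at h
  rw [sub_self, smul_zero] at h
  refine h.trans ?_
  gcongr
  refine L.opNorm_le_bound (inv_nonneg.2 hσ.le) fun x => ?_
  have hLx : L x = (σ⁻¹ • x, 0) := by simp [L]
  rw [hLx, Prod.norm_mk, norm_zero, max_eq_left (norm_nonneg _), norm_smul, Real.norm_eq_abs,
    abs_of_pos (inv_pos.2 hσ)]

/-- Pointwise estimate of the derivatives of the error of moving least squares approximation. -/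
theorem norm_iteratedFDeriv_error_le (hΩo : IsOpen Ω) (hΩc : Convex ℝ Ω)
    (hΩb : Bornology.IsBounded Ω) (hk : 1 ≤ k) (hm : k - 1 ≤ m) (hΦ : IsWeight k Φ)
    {Q : (Pt d → ℝ) → Pt d → ℝ} {x₀ : Pt d} (hx₀ : x₀ ∈ Ω) {σ κ R : ℝ} (hσ : 0 < σ) (hR : 0 ≤ R)
    {n : ℕ} {z : Fin n → Pt d} (hzΩ : ∀ j, x₀ + σ • z j ∈ Ω) (hzR : ∀ j, ‖z j‖ ≤ R)
    (hinv : (gram m Φ κ (0, z)).IsInvertible)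
    (hQ : ∀ᶠ x in 𝓝 x₀, (gram m Φ κ (σ⁻¹ • (x - x₀), z)).IsInvertible ∧ ∀ f : Pt d → ℝ,
      Q f x = ∑ j, f (x₀ + σ • z j) * shape m Φ κ j (σ⁻¹ • (x - x₀), z))
    {l : ℕ} (hl : l ≤ k) {C : ℝ} (hC : ∀ j, ‖iteratedFDeriv ℝ l (shape m Φ κ j) (0, z)‖ ≤ C)
    {f : Pt d → ℝ} (hf : MemCk Ω k f) :
    ‖iteratedFDeriv ℝ l (f - Q f) x₀‖ ≤
      (d : ℝ) ^ k * normCk Ω k f * (1 + n * (R ^ k * C)) * σ ^ (k - l) := by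
  set B := (d : ℝ) ^ k * normCk Ω k f with hB
  have hB0 : 0 ≤ B := mul_nonneg (by positivity) (normCk_nonneg _ _ _)
  have hlk : (l : WithTop ℕ∞) ≤ k := by exact_mod_cast hl
  have hfx : ContDiffAt ℝ k f x₀ := hf.1.contDiffAt (hΩo.mem_nhds hx₀)
  obtain ⟨p, hpdeg, hpx, hpk⟩ := exists_taylor_polynomial hk hfx
  set g : Pt d → ℝ := f - polyEval p with hg
  have hgC : ContDiffOn ℝ k g Ω := hf.1.sub (contDiff_polyEval p).contDiffOn
  have hDg : ∀ x ∈ Ω, ∀ n ≤ k, iteratedFDeriv ℝ n g x =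
      iteratedFDeriv ℝ n f x - iteratedFDeriv ℝ n (polyEval p) x := fun x hx n hn =>
    iteratedFDeriv_sub_apply
      ((hf.1.contDiffAt (hΩo.mem_nhds hx)).of_le (by exact_mod_cast hn))
      (contDiff_polyEval p).contDiffAt
  have hgk : ∀ x ∈ Ω, ‖iteratedFDeriv ℝ k g x‖ ≤ B := fun x hx => by
    rw [hDg x hx k le_rfl, hpk, sub_zero]
    exact hf.norm_iteratedFDeriv_le hΩb le_rfl hx
  have hg0 : ∀ n < k, iteratedFDeriv ℝ n g x₀ = 0 := fun n hn => by
    rw [hDg x₀ hx₀ n hn.le, hpx n hn, sub_self]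
  have hgy : ∀ j, |g (x₀ + σ • z j)| ≤ B * (σ * R) ^ k := by
    intro j
    have h1 := norm_iteratedFDeriv_le_of_vanishing hΩo hΩc hgC hB0 hgk hx₀ hg0 k le_rfl _ (hzΩ j)
    rw [Nat.sub_self, norm_iteratedFDeriv_zero, add_sub_cancel_left, norm_smul,
      Real.norm_eq_abs, Real.norm_eq_abs, abs_of_pos hσ] at h1
    refine h1.trans ?_
    have := hzR j
    gcongr
  have hshape := contDiffAt_shape_affine hΦ hinv x₀ σ
  -- By reproduction `f` may be replaced by the remainder `g`. The sites `z` stay fixed near `x₀`,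
  -- so the values of `g` there are constants under differentiation.
  have hev : f - Q f =ᶠ[𝓝 x₀]
      g - ∑ j, g (x₀ + σ • z j) • fun x => shape m Φ κ j (σ⁻¹ • (x - x₀), z) := by
    filter_upwards [hQ] with x hx
    have hrep := sum_shape_polyEval x₀ σ hx.1 p (hpdeg.trans hm)
    rw [smul_smul, mul_inv_cancel₀ hσ.ne', one_smul, add_sub_cancel] at hrep
    simp only [hg, Pi.sub_apply, Finset.sum_apply, Pi.smul_apply, smul_eq_mul, sub_mul,
      Finset.sum_sub_distrib]
    rw [hx.2 f, hrep]
    ring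
  have hsm : ∀ j ∈ Finset.univ, ContDiffAt ℝ l
      (g (x₀ + σ • z j) • fun x => shape m Φ κ j (σ⁻¹ • (x - x₀), z)) x₀ := fun j _ =>
    contDiffAt_const.smul ((hshape j).of_le hlk)
  rw [(hev.iteratedFDeriv ℝ l).self_of_nhds, iteratedFDeriv_sub_apply
    ((hgC.contDiffAt (hΩo.mem_nhds hx₀)).of_le hlk)
    (by rw [Finset.sum_fn]; exact ContDiffAt.sum hsm),
    iteratedFDeriv_sum_apply hsm]
  have hfirst : ‖iteratedFDeriv ℝ l g x₀‖ ≤ B * σ ^ (k - l) := by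
    rcases hl.lt_or_eq with h | rfl
    · rw [hg0 l h, norm_zero]; positivity
    · rw [Nat.sub_self, pow_zero, mul_one]; exact hgk x₀ hx₀
  have hterm : ∀ j ∈ Finset.univ, ‖iteratedFDeriv ℝ l
      (g (x₀ + σ • z j) • fun x => shape m Φ κ j (σ⁻¹ • (x - x₀), z)) x₀‖ ≤
        B * (R ^ k * C) * σ ^ (k - l) := by
    intro j _
    rw [iteratedFDeriv_const_smul_apply ((hshape j).of_le hlk), norm_smul, Real.norm_eq_abs]
    have h1 : ‖iteratedFDeriv ℝ l (fun x => shape m Φ κ j (σ⁻¹ • (x - x₀), z)) x₀‖ ≤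
        C * σ⁻¹ ^ l := by
      refine (norm_iteratedFDeriv_shape_affine_le hΦ hinv x₀ hσ j hl).trans ?_
      have := hC j
      gcongr
    calc _ ≤ B * (σ * R) ^ k * (C * σ⁻¹ ^ l) :=
          mul_le_mul (hgy j) h1 (norm_nonneg _) (by positivity)
      _ = B * (R ^ k * C) * σ ^ (k - l) := by
          rw [mul_pow, pow_sub₀ _ hσ.ne' hl, inv_pow]
          ring
  refine (norm_sub_le _ _).trans ((add_le_add hfirst (norm_sum_le_of_le _ hterm)).trans_eq ?_)
  rw [Finset.sum_const, Finset.card_univ, Fintype.card_fin, nsmul_eq_mul]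
  ring

/-- Polynomial reproduction and the single-level error estimate. -/
theorem exists_reproduction_and_errorConst (hd : 0 < d) (hΩo : IsOpen Ω) (hΩn : Ω.Nonempty)
    (hΩc : Convex ℝ Ω) (hΩb : Bornology.IsBounded Ω) (hk : 1 ≤ k) (hm : k - 1 ≤ m)
    (hΦ : IsWeight k Φ) :
    ∃ ν₀ : ℝ, 1 < ν₀ ∧ ∃ H : ℝ, 0 < H ∧ ∀ ν : ℝ, ν₀ ≤ ν → ∀ cq : ℝ, 1 ≤ cq →
      (∀ X : Finset (Pt d), QuasiUniform Ω cq X → fillDist Ω X ≤ H →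
        Reproduces Ω m Φ (ν * fillDist Ω X) X) ∧
      ∀ l : ℕ, l ≤ k → ∃ C : ℝ, IsErrorConst Ω m k Φ ν cq H l C := by
  obtain ⟨ν₀, hν₀, H, hH, M, hM, c, hc, hcoer⟩ :=
    exists_uniform_coercivity m hΦ hΩo hΩn hΩc hΩb
  refine ⟨ν₀, hν₀, H, hH, fun ν hν cq hcq => ?_⟩
  have hν0 : 0 < ν := by linarith
  -- Rescaled by `σ = M * h`, the radius `2 * δ = 2 * ν * h` becomes `2 * ν / M`, and the separation
  -- `2 * h / cq` becomes `2 / (cq * M)`.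
  obtain ⟨N, hN⟩ := exists_card_bound d (2 * ν / M) (s := 2 / (cq * M)) (by positivity)
  have hlocal : ∀ X : Finset (Pt d), QuasiUniform Ω cq X → fillDist Ω X ≤ H → ∀ x₀ ∈ closure Ω,
      ∃ (n : ℕ) (z : Fin n → Pt d), n ≤ N ∧ (∀ j, x₀ + (M * fillDist Ω X) • z j ∈ Ω) ∧
        (∀ j, ‖z j‖ ≤ 2 * ν / M) ∧
        (∀ v : Coeff d m, ‖v‖ = 1 → c ≤ inner ℝ v (gram m Φ (M / ν) (0, z) v)) ∧
        ∀ᶠ x in 𝓝 x₀, (gram m Φ (M / ν) ((M * fillDist Ω X)⁻¹ • (x - x₀), z)).IsInvertible ∧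
          ∀ f : Pt d → ℝ, quasiInterp Ω m Φ ν X f x = ∑ j, f (x₀ + (M * fillDist Ω X) • z j) *
            shape m Φ (M / ν) j ((M * fillDist Ω X)⁻¹ • (x - x₀), z) := by
    intro X hX hXH x₀ hx₀
    have hh := fillDist_pos hd hΩo hΩn hΩb hX.nonempty hX.subset
    set h := fillDist Ω X with hhdef
    have hσ : 0 < M * h := by positivity
    have hδ : 0 < ν * h := by positivity
    obtain ⟨n, z, hinj, hzX, hzR, hcover, hsum⟩ := exists_local_configuration hΦ X x₀ hσ hδ
    have hκ : M * h / (ν * h) = M / ν := mul_div_mul_right _ _ hh.ne'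
    have hR : 2 * (ν * h) / (M * h) = 2 * ν / M := by
      rw [← mul_assoc]; exact mul_div_mul_right _ _ hh.ne'
    rw [hκ] at hsum
    rw [hR] at hzR
    have hco := hcoer ν hν X hX.nonempty hX.subset hh hXH x₀ hx₀ n z hcover
    refine ⟨n, z, hN n z hzR fun i j hij => ?_, fun j => hX.subset (hzX j), hzR, hco,
      eventually_mls_eq_sum_shape hΦ hσ hδ hsum (isInvertible_of_coercive hc hco)⟩
    have hne : x₀ + (M * h) • z i ≠ x₀ + (M * h) • z j := fun heq =>
      hij (hinj (smul_right_injective _ hσ.ne' (add_left_cancel heq)))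
    have h1 := hX.fillDist_le (by linarith) (hzX i) (hzX j) hne
    rw [dist_add_left, dist_smul₀, Real.norm_eq_abs, abs_of_pos hσ] at h1
    rw [div_le_iff₀ (by positivity)]
    have h2 : h * 2 ≤ h * (dist (z i) (z j) * (cq * M)) := by
      have : fillDist Ω X = h := rfl
      rw [this] at h1
      linarith
    exact le_of_mul_le_mul_left h2 hh
  refine ⟨fun X hX hXH p hp x hx => ?_, fun l hl => ?_⟩
  · obtain ⟨n, z, -, -, -, -, hev⟩ := hlocal X hX hXH x (subset_closure hx)
    have hh := fillDist_pos hd hΩo hΩn hΩb hX.nonempty hX.subset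
    obtain ⟨hinv, hrep⟩ := hev.self_of_nhds
    have h1 := sum_shape_polyEval x (M * fillDist Ω X) hinv p hp
    rw [sub_self, smul_zero, smul_zero, add_zero] at h1
    have h2 := hrep (polyEval p)
    rw [sub_self, smul_zero, h1] at h2
    exact h2
  · choose C hC0 hC using fun (i : Fin (l + 1)) (n : ℕ) =>
      exists_bound_iteratedFDeriv_shape (m := m) hΦ.contDiff (M / ν) (2 * ν / M) hc n
        (l := i) (by omega)
    set R := 2 * ν / M with hR
    have hR0 : 0 ≤ R := by positivity
    let D : Fin (l + 1) → ℝ := fun i => ∑ n ∈ Finset.range (N + 1), C i n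
    have hD0 : ∀ i, 0 ≤ D i := fun i => Finset.sum_nonneg fun n _ => hC0 i n
    -- `A i` serves the derivatives of order `i ≤ l`; the surplus `h ^ (l - i)` is absorbed into `H
    -- ^ (l - i)`.
    let A : Fin (l + 1) → ℝ := fun i =>
      (d : ℝ) ^ k * (1 + N * (R ^ k * D i)) * M ^ (k - (i : ℕ)) * H ^ (l - (i : ℕ))
    have hA0 : ∀ i, 0 ≤ A i := fun i => by
      have := hD0 i
      positivity
    refine ⟨1 + ∑ i, A i, by linarith [Finset.sum_nonneg fun i (_ : i ∈ Finset.univ) => hA0 i],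
      fun X hX f hf => ?_⟩
    have hh := fillDist_pos hd hΩo hΩn hΩb hX.quasiUniform.nonempty hX.quasiUniform.subset
    have hloc := hlocal X hX.quasiUniform hX.fill_le
    set h := fillDist Ω X with hhdef
    have hσ : 0 < M * h := by positivity
    constructor
    · refine MemCk.of_le (hf.sub_of_contDiffAt hΩo fun x₀ hx₀ => ?_) hl
      obtain ⟨n, z, -, -, -, hco, hev⟩ := hloc x₀ hx₀
      have hshape := contDiffAt_shape_affine hΦ (isInvertible_of_coercive hc hco) x₀ (M * h)
      have : ContDiffAt ℝ k (fun x => ∑ j, f (x₀ + (M * h) • z j) *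
          shape m Φ (M / ν) j ((M * h)⁻¹ • (x - x₀), z)) x₀ :=
        ContDiffAt.sum fun j _ => contDiffAt_const.mul (hshape j)
      exact this.congr_of_eventuallyEq (hev.mono fun x hx => hx.2 f)
    · have hn0 := normCk_nonneg Ω k f
      have hS0 := Finset.sum_nonneg fun i (_ : i ∈ Finset.univ) => hA0 i
      refine normCk_le (by positivity) fun i hi x₀ hx₀ α => ?_
      obtain ⟨n, z, hnN, hzΩ, hzR, hco, hev⟩ := hloc x₀ (subset_closure hx₀)
      set i' : Fin (l + 1) := ⟨i, by omega⟩ with hi'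
      have hCD : ∀ j, ‖iteratedFDeriv ℝ i (shape m Φ (M / ν) j) (0, z)‖ ≤ D i' := fun j =>
        (hC i' n z hzR hco j).trans (Finset.single_le_sum (f := fun n => C i' n)
          (fun n _ => hC0 i' n) (Finset.mem_range.2 (by omega)))
      have hD' := hD0 i'
      have herr := norm_iteratedFDeriv_error_le hΩo hΩc hΩb hk hm hΦ hx₀ hσ hR0 hzΩ hzR
        (isInvertible_of_coercive hc hco) hev (hi.trans hl) hCD hf
      have hnN' : (n : ℝ) ≤ N := by exact_mod_cast hnN
      have hpow : h ^ (k - i) ≤ H ^ (l - i) * h ^ (k - l) := by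
        rw [show k - i = (l - i) + (k - l) by omega, pow_add]
        have : h ≤ H := hX.fill_le
        gcongr
      calc |partialDeriv α (f - quasiInterp Ω m Φ ν X f) x₀|
          ≤ ‖iteratedFDeriv ℝ i (f - quasiInterp Ω m Φ ν X f) x₀‖ :=
            abs_partialDeriv_le_norm _ _ _
        _ ≤ (d : ℝ) ^ k * normCk Ω k f * (1 + n * (R ^ k * D i')) * (M * h) ^ (k - i) := herr
        _ ≤ (d : ℝ) ^ k * normCk Ω k f * (1 + N * (R ^ k * D i')) *
            (M ^ (k - i) * (H ^ (l - i) * h ^ (k - l))) := by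
            rw [mul_pow]
            gcongr
        _ = A i' * h ^ (k - l) * normCk Ω k f := by
            simp only [A, hi']
            ring
        _ ≤ (1 + ∑ i, A i) * h ^ (k - l) * normCk Ω k f := by
            have := Finset.single_le_sum (f := A) (fun i _ => hA0 i) (Finset.mem_univ i')
            gcongr
            linarith

end SingleLevel

/-! ### The multiscale iteration. -/

section Multiscale

variable {d : ℕ} {Ω : Set (Pt d)} {k m : ℕ} {Φ : Pt d → ℝ}

theorem sub_approximant (Ω : Set (Pt d)) (m : ℕ) (Φ : Pt d → ℝ) (ν : ℝ) (X : ℕ → Finset (Pt d))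
    (f : Pt d → ℝ) (n : ℕ) : f - approximant Ω m Φ ν X f n = residual Ω m Φ ν X f n := by
  induction n with
  | zero => exact sub_zero f
  | succ n ih => rw [approximant, residual, ← ih, sub_add_eq_sub_sub]

theorem fillDist_eq_pow {X : ℕ → Finset (Pt d)} {μ : ℝ}
    (hX : ∀ j : ℕ, 1 ≤ j → fillDist Ω (X (j + 1)) = μ * fillDist Ω (X j)) (n : ℕ) :
    fillDist Ω (X (n + 1)) = μ ^ n * fillDist Ω (X 1) := by
  induction n with
  | zero => simp
  | succ n ih => rw [hX _ (by omega), ih]; ring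

/-- For `l = k` the power of the fill distance is `h ^ 0`, so each level contributes just the factor
`C`. -/
theorem residual_memCk_and_norm_le {ν cq H C : ℝ} (hC : IsErrorConst Ω m k Φ ν cq H k C)
    {X : ℕ → Finset (Pt d)} (hX : ∀ j : ℕ, 1 ≤ j → IsDataSet Ω m Φ ν cq H (X j)) {f : Pt d → ℝ}
    (hf : MemCk Ω k f) (n : ℕ) :
    MemCk Ω k (residual Ω m Φ ν X f n) ∧
      normCk Ω k (residual Ω m Φ ν X f n) ≤ C ^ n * normCk Ω k f := by
  induction n with
  | zero => exact ⟨hf, by simp [residual]⟩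
  | succ n ih =>
    obtain ⟨h1, h2⟩ := hC.2 (X (n + 1)) (hX _ (by omega)) _ ih.1
    refine ⟨h1, h2.trans ?_⟩
    rw [Nat.sub_self, pow_zero, mul_one, pow_succ', mul_assoc]
    exact mul_le_mul_of_nonneg_left ih.2 hC.1.le

/-- The first `n - 1` levels are measured in `C^k`, only the last in the sup norm; hence the
division by `Cₖ`. All powers of `μ` come from the last fill distance `μ ^ n * h₀`. -/
theorem multiscale_error_le {ν cq H C₀ Cₖ : ℝ} (hC₀ : IsErrorConst Ω m k Φ ν cq H 0 C₀)
    (hCₖ : IsErrorConst Ω m k Φ ν cq H k Cₖ) {μ : ℝ} (hμ : 0 < μ)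
    {X : ℕ → Finset (Pt d)} (hX : ∀ j : ℕ, 1 ≤ j → IsDataSet Ω m Φ ν cq H (X j))
    (hh : ∀ j : ℕ, 1 ≤ j → fillDist Ω (X (j + 1)) = μ * fillDist Ω (X j)) {f : Pt d → ℝ}
    (hf : MemCk Ω k f) {n : ℕ} (hn : 1 ≤ n) :
    MemCk Ω 0 (f - approximant Ω m Φ ν X f n) ∧
      normCk Ω 0 (f - approximant Ω m Φ ν X f n) ≤
        C₀ * (fillDist Ω (X 1) / μ) ^ k / Cₖ * (Cₖ * μ ^ k) ^ n * normCk Ω k f := by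
  obtain ⟨n, rfl⟩ : ∃ j, n = j + 1 := ⟨n - 1, by omega⟩
  rw [sub_approximant]
  obtain ⟨h1, h2⟩ := residual_memCk_and_norm_le hCₖ hX hf n
  obtain ⟨h3, h4⟩ := hC₀.2 (X (n + 1)) (hX _ (by omega)) _ h1
  refine ⟨h3, h4.trans ?_⟩
  have hfill : 0 ≤ fillDist Ω (X (n + 1)) := by
    refine Real.sSup_nonneg ?_
    rintro _ ⟨x, -, rfl⟩
    exact Metric.infDist_nonneg
  have hC₀' := hC₀.1
  have hCₖ' := hCₖ.1
  calc C₀ * fillDist Ω (X (n + 1)) ^ (k - 0) * normCk Ω k (residual Ω m Φ ν X f n)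
      ≤ C₀ * fillDist Ω (X (n + 1)) ^ (k - 0) * (Cₖ ^ n * normCk Ω k f) := by gcongr
    _ = _ := by
      rw [fillDist_eq_pow hh, Nat.sub_zero, div_pow, mul_pow, mul_pow, pow_succ Cₖ, ← pow_mul,
        ← pow_mul, Nat.mul_succ, pow_add, mul_comm n k]
      field_simp

end Multiscale

end MultiscaleMLS

/-- First part: for a large enough support factor and small enough fill distances, the operators
reproduce polynomials and constants `C_{k,ℓ}` of the single-level error estimate exist, uniformly in
the data sets. Second part: the multiscale bound, with any such constants `C_{k,0}`, `C_{k,k}`;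
here `h_0 = h_1 / μ`. -/
theorem theorem4p1 {d : ℕ} (hd : 0 < d) (Ω : Set (MultiscaleMLS.Pt d))
    (hΩo : IsOpen Ω) (hΩn : Ω.Nonempty) (hΩc : Convex ℝ Ω) (hΩb : Bornology.IsBounded Ω)
    (k m : ℕ) (hk : 1 ≤ k) (hm : k - 1 ≤ m)
    (Φ : MultiscaleMLS.Pt d → ℝ) (hΦ : MultiscaleMLS.IsWeight k Φ) :
    (∃ ν₀ : ℝ, 1 < ν₀ ∧ ∃ H : ℝ, 0 < H ∧
      ∀ ν : ℝ, ν₀ ≤ ν → ∀ cq : ℝ, 1 ≤ cq →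
        (∀ X : Finset (MultiscaleMLS.Pt d), MultiscaleMLS.QuasiUniform Ω cq X →
          MultiscaleMLS.fillDist Ω X ≤ H →
          MultiscaleMLS.Reproduces Ω m Φ (ν * MultiscaleMLS.fillDist Ω X) X) ∧
        ∀ l : ℕ, l ≤ k → ∃ C : ℝ, MultiscaleMLS.IsErrorConst Ω m k Φ ν cq H l C) ∧
    (∀ ν : ℝ, 1 < ν → ∀ cq : ℝ, 1 ≤ cq → ∀ H : ℝ, 0 < H → ∀ C₀ Cₖ : ℝ,
      MultiscaleMLS.IsErrorConst Ω m k Φ ν cq H 0 C₀ →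
      MultiscaleMLS.IsErrorConst Ω m k Φ ν cq H k Cₖ →
      ∀ μ : ℝ, 0 < μ → μ < 1 → ∀ X : ℕ → Finset (MultiscaleMLS.Pt d),
        (∀ j : ℕ, 1 ≤ j → MultiscaleMLS.IsDataSet Ω m Φ ν cq H (X j)) →
        (∀ j : ℕ, 1 ≤ j →
          MultiscaleMLS.fillDist Ω (X (j + 1)) = μ * MultiscaleMLS.fillDist Ω (X j)) →
        ∀ f : MultiscaleMLS.Pt d → ℝ, MultiscaleMLS.MemCk Ω k f →
          (∀ n : ℕ, 1 ≤ n →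
            MultiscaleMLS.MemCk Ω 0 (f - MultiscaleMLS.approximant Ω m Φ ν X f n) ∧
            MultiscaleMLS.normCk Ω 0 (f - MultiscaleMLS.approximant Ω m Φ ν X f n) ≤
              C₀ * (MultiscaleMLS.fillDist Ω (X 1) / μ) ^ k / Cₖ * (Cₖ * μ ^ k) ^ n *
                MultiscaleMLS.normCk Ω k f) ∧
          (Cₖ * μ ^ k < 1 →
            Filter.Tendsto
              (fun n => MultiscaleMLS.normCk Ω 0 (f - MultiscaleMLS.approximant Ω m Φ ν X f n))
              Filter.atTop (nhds 0))) := by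
  refine ⟨MultiscaleMLS.exists_reproduction_and_errorConst hd hΩo hΩn hΩc hΩb hk hm hΦ, ?_⟩
  intro ν _ cq _ H _ C₀ Cₖ hC₀ hCₖ μ hμ _ X hX hh f hf
  refine ⟨fun n hn => MultiscaleMLS.multiscale_error_le hC₀ hCₖ hμ hX hh hf hn, fun hlt => ?_⟩
  have hq : 0 ≤ Cₖ * μ ^ k := mul_nonneg hCₖ.1.le (pow_nonneg hμ.le k)
  have hlim := ((tendsto_pow_atTop_nhds_zero_of_lt_one hq hlt).const_mul
    (C₀ * (MultiscaleMLS.fillDist Ω (X 1) / μ) ^ k / Cₖ)).mul_const (MultiscaleMLS.normCk Ω k f)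
  rw [mul_zero, zero_mul] at hlim
  refine tendsto_of_tendsto_of_tendsto_of_le_of_le' tendsto_const_nhds hlim
    (Filter.Eventually.of_forall fun n => MultiscaleMLS.normCk_nonneg _ _ _) ?_
  filter_upwards [Filter.eventually_ge_atTop 1] with n hn
  exact (MultiscaleMLS.multiscale_error_le hC₀ hCₖ hμ hX hh hf hn).2
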